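/- **Setting.** An input of size $n\ge 1$ consists of servers $s_1\le\dots\le s_n$ and requests $r_1,\dots,r_n$, all real. The servers are known in advance, the requests arrive one by one, and each must be matched irrevocably, upon arrival, to an unmatched server at cost equal to their distance; $\mathrm{OPT}$ is the minimal total cost of a perfect matching. A (deterministic or randomized) online algorithm $A$ without advice is *$c(n)$-competitive* if there is a constant $a$ such that on every input of every size $n$ its (expected) cost is at most $c(n)\cdot\mathrm{OPT}+a$. An online algorithm with advice may in addition read bits, one after the other, from an infinite tape, which an oracle that knows the whole input (but not the random choices) has written. **Algorithm LR** (one bit of advice per request at most). A request $r$ is matched to an unmatched server at $r$ if there is one; otherwise, if all unmatched servers lie on one side of $r$, to the nearest one; otherwise a bit is read, and $r$ is matched to the nearest unmatched server to its left (bit $0$) or to its right (bit $1$). **Algorithm $\mathrm{DIVIDE}_k$** ($1\le k\le n$; subroutine $A$; servers in $[1,N-1]$ with $s_1=1$, where $N\in\mathbb Z^+$; integer requests). Split the servers, in order, into consecutive blocks $S_1,\dots,S_k$, the first $n \bmod k$ of size $\lceil n/k\rceil$ and the others of size $\lfloor n/k\rfloor$. Let $p_i$ be the midpoint of the last server of $S_i$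 and the first server of $S_{i+1}$, and $B_i=(p_{i-1},p_i]$ with $p_0=-\infty$, $p_k=\infty$. The position of a request is understood to be cut off at $0$ and at $N$. The advice refers to an optimal matching that is monotone in the positions. For $i=2,\dots,k$ a word $q_{i,L}$ is read: the position of the rightmost request in $B_i$ whose server is in some $S_j$, $j<i$ ($0$ if there is none). For $i=1,\dots,k-1$ a word $q_{i,R}$ is read: the position of the leftmost request in $B_i$ whose server is in some $S_j$, $j>i$ (the all-1 word if there is none). These words have as many bits as $N$ has binary digits. Then, for $i=1,\dots,k-1$, if $q_{i,R}$ is not the all-1 word, two numbers are read, each with as many bits as $n$ has binary digits: $d_{i,R}$, the number of requests at $q_{i,R}$ with server in $S_i$, and $m_{i,R}$, the number of requests in $B_i$ with server in some $S_j$, $j>i$; the first $m_{i,R}$ servers of $\bigcup_{j>i}S_j$ not yet marked in this round are marked. Then, for $i=k,\dots,2$, if $q_{i,L}\neq0$, two such numbers are read: $d_{i,L}$, the number of requests at $q_{i,L}$ with server in $\bigcup_{j\ge i}S_j$, and $m_{i,L}$, the number of requests in $B_i$ with server in some $S_j$, $j<i$; the last $m_{i,L}$ servers of $\bigcup_{j<i}S_j$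 not yet marked in this round are marked. After that, requests are served as follows. A request in $B_i$ at a position $>q_{i,R}$ is marked "right", one at a position $<q_{i,L}$ is marked "left"; if $q_{i,L}\ne q_{i,R}$, then of the requests at $q_{i,R}$ (at $q_{i,L}$) the first $d_{i,R}$ (the first $d_{i,L}$) are left unmarked and the later ones are marked "right" ("left"); if $q_{i,L}=q_{i,R}$, then of the requests at this point the first $d_{i,R}$ are left unmarked, the next ones, up to the $d_{i,L}$-th, are marked "right", and the later ones "left"; all other requests are left unmarked. Marked requests are served by LR on the marked servers, with advice bit $1$ for "right" and $0$ for "left" (these bits are produced by $\mathrm{DIVIDE}_k$ itself); unmarked requests in $B_i$ are served by $A$ on the unmarked servers of $S_i$. **Algorithm RESCALE** (for arbitrary real servers and requests). Put $s_i'=n^3(s_i-s_1)+1$, $r_i'=\lfloor n^3(r_i-s_1)\rfloor+1$ and $N=\lceil s_n'-s_1'\rceil+2$. Execute $\mathrm{DIVIDE}_k$ on this modified input, and match $r_i$ to $s_j$ when $\mathrm{DIVIDE}_k$ matches $r_i'$ to $s_j'$. **Theorem.** There is an absolute constant $C$ with the following property. Let $c:\mathbb N\to\mathbb R$ be nondecreasing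 with $c(n)=o(n^2)$, and let $A$ be a $c(n)$-competitive (deterministic or randomized) online algorithm. Then there is a constant $b$, depending only on $A$ and $c$, such that for all $1\le k\le n$ and every input of size $n$ there is an advice tape with which RESCALE, with subroutine $A$, produces a perfect matching of (expected) cost at most $$c(\lceil n/k\rceil)\cdot \mathrm{OPT}+b$$ and reads at most $$C\,k\,\bigl(\max\{0,\log(s_n-s_1)\}+\log n\bigr)$$ bits of advice (where $\log (s_n-s_1)$ is replaced by $0$ if $s_n=s_1$). That is, RESCALE is $c(n/k)$-competitive and reads $O(k(\log(s_n-s_1)+\log n))$ bits of advice. -/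

import Mathlib

open MeasureTheory

noncomputable section

/-! ### Inputs, matchings, optimal cost

An input is a list `s` of servers and a list `r` of requests of the same length.  A matching is a list
of (0-based) server indices: its `t`-th entry is the server of the `t`-th request. -/

structure IsInput (s r : List ℝ) : Prop where
  sorted : s.Pairwise (· ≤ ·)
  length_eq : r.length = s.length

/-- `m` is a permutation of the server indices. -/
def IsMatching (s : List ℝ) (m : List ℕ) : Prop :=
  m.Perm (List.range s.length)

/-- The total distance between the requests and their servers. -/
def matchingCost (s r : List ℝ) (m : List ℕ) : ℝ :=
  (List.zipWith (fun x j => |x - s.getD j 0|) r m).sum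

/-- The optimal offline cost (a minimum over finitely many matchings). -/
def optCost (s r : List ℝ) : ℝ :=
  sInf (matchingCost s r '' {m | IsMatching s m})

/-- `s_n - s_1`. -/
def serverSpan (s : List ℝ) : ℝ := s.getLastD 0 - s.headD 0

/-! ### Online algorithms without advice -/

/-- `A s past x` is the index of the server used for the request `x`, when the servers are `s` and
`past` is the list of the earlier requests, in order of arrival. -/
abbrev OnlineAlg := List ℝ → List ℝ → ℝ → ℕ

namespace OnlineAlg

def serve (A : OnlineAlg) (s : List ℝ) : List ℝ → List ℝ → List ℕ
  | _, [] => []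
  | past, x :: xs => A s past x :: serve A s (past ++ [x]) xs

/-- The list of the servers chosen by `A` for the request sequence `r`. -/
def output (A : OnlineAlg) (s r : List ℝ) : List ℕ := A.serve s [] r

end OnlineAlg

/-- A random matching: a matching for every outcome, and a measurable function of the outcome. -/
structure IsRandomMatching {Ω : Type*} [MeasurableSpace Ω] (s : List ℝ) (f : Ω → List ℕ) : Prop where
  isMatching : ∀ ω, IsMatching s (f ω)
  measurable : ∀ m, MeasurableSet {ω | f ω = m}

/-- The possibly randomized online algorithm `A` (a random choice of a deterministic one, with outcome
`ω` distributed according to `μ`) is `c(n)`-competitive: on inputs of size `n` its expected cost is at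
most `c(n)` times the optimum, plus a constant.  Deterministic algorithms are the case of a one-point
`Ω`. -/
def IsCompetitive {Ω : Type*} [MeasurableSpace Ω] (μ : Measure Ω) (A : Ω → OnlineAlg)
    (c : ℕ → ℝ) : Prop :=
  ∃ a : ℝ, ∀ s r : List ℝ, IsInput s r →
    IsRandomMatching s (fun ω => (A ω).output s r) ∧
    ∫ ω, matchingCost s r ((A ω).output s r) ∂μ ≤ c s.length * optCost s r + a

/-! ### Reading advice from a tape -/

/-- A computation that may read bits, one after the other, from an advice tape. -/
inductive AdviceProg (β : Type) : Type
  | ret (b : β) : AdviceProg β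
  | read (next : Bool → AdviceProg β) : AdviceProg β

namespace AdviceProg

def andThen {β γ : Type} : AdviceProg β → (β → AdviceProg γ) → AdviceProg γ
  | ret b, f => f b
  | read next, f => read fun bit => (next bit).andThen f

instance : Monad AdviceProg where
  pure := ret
  bind := andThen

/-- The result on the infinite tape `φ`, together with the number of bits read. -/
def run {β : Type} : AdviceProg β → (ℕ → Bool) → β × ℕ
  | ret b, _ => (b, 0)
  | read next, φ =>
    let res := (next (φ 0)).run (fun i => φ (i + 1))
    (res.1, res.2 + 1)

/-- Read a `w`-bit word, as a number in binary, most significant bit first. -/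
def readWord : ℕ → AdviceProg ℕ
  | 0 => pure 0
  | w + 1 => read fun bit => do
      let v ← readWord w
      pure (bit.toNat * 2 ^ w + v)

/-- Run `f i` for the indices `i` of a list, in this order, and collect the results in a function of
the index, with the value `b₀` at all other indices. -/
def forIndices {β : Type} (b₀ : β) (f : ℕ → AdviceProg β) : List ℕ → AdviceProg (ℕ → β)
  | [] => pure fun _ => b₀
  | i :: is => do
      let b ← f i
      let g ← forIndices b₀ f is
      pure (Function.update g i b)

end AdviceProg

/-- An online algorithm with advice in the tape model: it may read advice when it gets the servers,
and again upon the arrival of every request; then it answers with the index of a server. -/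
structure AdviceAlg where
  State : Type
  init : List ℝ → AdviceProg State
  step : State → ℝ → AdviceProg (ℕ × State)

namespace AdviceAlg

def serve (R : AdviceAlg) : R.State → List ℝ → AdviceProg (List ℕ)
  | _, [] => pure []
  | st, x :: xs => do
      let res ← R.step st x
      let js ← R.serve res.2 xs
      pure (res.1 :: js)

/-- The servers chosen for the request sequence `r` with the advice tape `φ`. -/
def output (R : AdviceAlg) (s r : List ℝ) (φ : ℕ → Bool) : List ℕ :=
  ((R.init s >>= fun st => R.serve st r).run φ).1

/-- The number of advice bits read on the request sequence `r` with the advice tape `φ`. -/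
def bitsRead (R : AdviceAlg) (s r : List ℝ) (φ : ℕ → Bool) : ℕ :=
  ((R.init s >>= fun st => R.serve st r).run φ).2

end AdviceAlg

/-! ### Algorithm LR -/

/-- The state of LR: the unmatched servers (index and position), in increasing order. -/
def lrInit (s : List ℝ) : List (ℕ × ℝ) := s.zipIdx.map Prod.swap

def lrChoose (st : List (ℕ × ℝ)) (x : ℝ) : AdviceProg ℕ :=
  match st.filter (fun p => p.2 = x) with
  | p :: _ => pure p.1
  | [] =>
    match (st.filter (fun p => p.2 < x)).getLast?, (st.filter (fun p => x < p.2)).head? with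
    | none, some p => pure p.1
    | some p, none => pure p.1
    | some p, some q => AdviceProg.read fun bit => pure (if bit then q.1 else p.1)
    | none, none => pure 0

def lrStep (st : List (ℕ × ℝ)) (x : ℝ) : AdviceProg (ℕ × List (ℕ × ℝ)) := do
  let j ← lrChoose st x
  pure (j, st.filter fun p => p.1 ≠ j)

/-- Algorithm LR. -/
def LR : AdviceAlg where
  State := List (ℕ × ℝ)
  init s := pure (lrInit s)
  step := lrStep

/-! ### Algorithm DIVIDE -/

/-- The number of servers in the first `i` of the `k` blocks of `n` servers: the first `n mod k` blocks
have `⌈n/k⌉` servers each, the other ones `⌊n/k⌋`.  So `S_i` (`1 ≤ i ≤ k`) consists of the servers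
with 0-based index `j`, `blockEnd n k (i-1) ≤ j < blockEnd n k i`. -/
def blockEnd (n k i : ℕ) : ℕ :=
  if i ≤ n % k then i * (n ⌈/⌉ k) else (n % k) * (n ⌈/⌉ k) + (i - n % k) * (n / k)

/-- What DIVIDE knows after reading the advice. `qL i = none` and `qR i = none` mean that no request of
the `i`-th block has to be served from the left, respectively from the right. -/
structure DivideSetup where
  servers : List ℝ
  k : ℕ
  N : ℕ
  qL : ℕ → Option ℕ
  qR : ℕ → Option ℕ
  dL : ℕ → ℕ
  mL : ℕ → ℕ
  dR : ℕ → ℕ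
  mR : ℕ → ℕ

inductive Mark
  | unmarked
  | right
  | left

namespace DivideSetup

variable (D : DivideSetup)

def n : ℕ := D.servers.length

/-- The division point `p_i` between the blocks `i` and `i + 1`, for `1 ≤ i ≤ k - 1`: the midpoint of
the last server of `S_i` and the first server of `S_{i+1}`. -/
def p (i : ℕ) : ℝ :=
  (D.servers.getD (blockEnd D.n D.k i - 1) 0 + D.servers.getD (blockEnd D.n D.k i) 0) / 2

/-- The number `j` of the block `B_j = (p_{j-1}, p_j]` of a point, where `p_0 = -∞`, `p_k = ∞`. -/
def block (x : ℝ) : ℕ := 1 + ((List.Ico 1 D.k).filter fun i => D.p i < x).length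

/-- The position of an integer point, cut off at `0` and at `N`. -/
def pos (x : ℝ) : ℕ := ⌊min x D.N⌋₊

/-- First marking procedure, for the blocks `1, …, k - 1`. -/
def markedR : List ℕ :=
  (List.Ico 1 D.k).foldl (fun M i => M ++
    ((List.range D.n).filter fun j => blockEnd D.n D.k i ≤ j ∧ j ∉ M).take (D.mR i)) []

/-- Second marking procedure, for the blocks `k, k - 1, …, 2`. -/
def markedL : List ℕ :=
  (List.Ico 2 (D.k + 1)).reverse.foldl (fun M i => M ++
    ((List.range D.n).reverse.filter fun j => j < blockEnd D.n D.k (i - 1) ∧ j ∉ M).take (D.mL i)) []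

/-- The indices of the marked servers, in increasing order. -/
def markedServers : List ℕ :=
  (List.range D.n).filter fun j => j ∈ D.markedR ∨ j ∈ D.markedL

/-- The indices of the unmarked servers of `S_i`, in increasing order. -/
def unmarkedServers (i : ℕ) : List ℕ :=
  (List.range D.n).filter fun j =>
    blockEnd D.n D.k (i - 1) ≤ j ∧ j < blockEnd D.n D.k i ∧ j ∉ D.markedR ∧ j ∉ D.markedL

/-- Positions of a list of servers given by indices. -/
def positions (l : List ℕ) : List ℝ := l.map fun j => D.servers.getD j 0

open Classical in
/-- The treatment of the request `x` after the requests in `past`.  In its block `i`, requests to the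
right of `q_{i,R}` are marked (to the right), requests to the left of `q_{i,L}` are marked (to the
left).  Of the requests at `q_{i,R}` the first `d_{i,R}` ones, and of the requests at `q_{i,L}` the
first `d_{i,L}` ones, are not served from the right, respectively from the left. If
`q_{i,L} = q_{i,R}`, this leaves first `d_{i,R}` unmarked requests, then, up to the `d_{i,L}`-th one,
requests marked to the right, and then requests marked to the left. -/
def mark (past : List ℝ) (x : ℝ) : Mark :=
  let i := D.block x
  let y := D.pos x
  let cnt := (past.filter fun z => D.pos z = y).length
  if (∃ q, D.qR i = some q ∧ q < y) then .right
  else if (∃ q, D.qL i = some q ∧ y < q) then .left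
  else if D.qR i = some y ∧ D.qL i = some y then
    if cnt < D.dR i then .unmarked else if cnt < D.dL i then .right else .left
  else if D.qR i = some y then
    if cnt < D.dR i then .unmarked else .right
  else if D.qL i = some y then
    if cnt < D.dL i then .unmarked else .left
  else .unmarked

end DivideSetup

/-- Reading the advice of DIVIDE, in four rounds: the words `q_{i,L}` for `i = 2, …, k` (`0` means that
there is no such request), the words `q_{i,R}` for `i = 1, …, k - 1` (the all-1 word means that there
is none), then `d_{i,R}` and `m_{i,R}` for `i = 1, …, k - 1`, and `d_{i,L}` and `m_{i,L}` for
`i = k, …, 2`, in the blocks where there is such a request. `Nat.size N` is the number of binary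
digits of `N`. -/
def divideRead (k N : ℕ) (s : List ℝ) : AdviceProg DivideSetup := do
  let w := Nat.size N
  let v := Nat.size s.length
  let qL ← AdviceProg.forIndices none (fun _ => do
    let q ← AdviceProg.readWord w
    pure (if q = 0 then none else some q)) (List.Ico 2 (k + 1))
  let qR ← AdviceProg.forIndices none (fun _ => do
    let q ← AdviceProg.readWord w
    pure (if q = 2 ^ w - 1 then none else some q)) (List.Ico 1 k)
  let readPair : Option ℕ → AdviceProg (ℕ × ℕ) := fun q =>
    match q with
    | none => pure (0, 0)
    | some _ => do
        let d ← AdviceProg.readWord v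
        let m ← AdviceProg.readWord v
        pure (d, m)
  let dmR ← AdviceProg.forIndices (0, 0) (fun i => readPair (qR i)) (List.Ico 1 k)
  let dmL ← AdviceProg.forIndices (0, 0) (fun i => readPair (qL i)) (List.Ico 2 (k + 1)).reverse
  pure
    { servers := s, k := k, N := N, qL := qL, qR := qR
      dL := fun i => (dmL i).1, mL := fun i => (dmL i).2
      dR := fun i => (dmR i).1, mR := fun i => (dmR i).2 }

/-- The state while serving requests: the requests so far, the unmarked requests of each block so far
(the input of `A` in this block), and the state of LR on the marked servers. -/
structure DivideState where
  setup : DivideSetup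
  past : List ℝ
  unmarked : ℕ → List ℝ
  lr : List (ℕ × ℝ)

def divideInit (k N : ℕ) (s : List ℝ) : AdviceProg DivideState := do
  let D ← divideRead k N s
  pure
    { setup := D, past := [], unmarked := fun _ => []
      lr := lrInit (D.positions D.markedServers) }

/-- Serve a marked request by LR, run on the marked servers and requests; `bit` is what LR finds on
its auxiliary tape if it reads a bit. -/
def divideMarkedStep (st : DivideState) (x : ℝ) (bit : Bool) : ℕ × DivideState :=
  let res := ((lrStep st.lr x).run fun _ => bit).1
  (st.setup.markedServers.getD res.1 0, { st with past := st.past ++ [x], lr := res.2 })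

/-- Serve an unmarked request of block `i` by `A`, run on the unmarked servers and requests of this
block. -/
def divideUnmarkedStep (A : OnlineAlg) (st : DivideState) (x : ℝ) : ℕ × DivideState :=
  let D := st.setup
  let i := D.block x
  let j := A (D.positions (D.unmarkedServers i)) (st.unmarked i) x
  ((D.unmarkedServers i).getD j 0,
    { st with
      past := st.past ++ [x]
      unmarked := Function.update st.unmarked i (st.unmarked i ++ [x]) })

def divideStep (A : OnlineAlg) (st : DivideState) (x : ℝ) : ℕ × DivideState :=
  match st.setup.mark st.past x with
  | .unmarked => divideUnmarkedStep A st x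
  | .right => divideMarkedStep st x true
  | .left => divideMarkedStep st x false

/-- Algorithm DIVIDE with `k` blocks and subroutine `A`, for servers in `[1, N - 1]`, the first one at
`1`, and for integer requests. -/
def DIVIDE (A : OnlineAlg) (k N : ℕ) : AdviceAlg where
  State := DivideState
  init := divideInit k N
  step st x := pure (divideStep A st x)

/-! ### Algorithm RESCALE -/

/-- `s' = n³ (s - s_1) + 1`. -/
def rescaleServer (s : List ℝ) (x : ℝ) : ℝ := (s.length : ℝ) ^ 3 * (x - s.headD 0) + 1

/-- `r' = ⌊n³ (r - s_1)⌋ + 1`. -/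
def rescaleRequest (s : List ℝ) (x : ℝ) : ℝ := ⌊(s.length : ℝ) ^ 3 * (x - s.headD 0)⌋ + 1

/-- `N = ⌈s'_n - s'_1⌉ + 2`. -/
def rescaleN (s : List ℝ) : ℕ := ⌈serverSpan (s.map (rescaleServer s))⌉₊ + 2

/-- Algorithm RESCALE: DIVIDE on the rescaled servers and the rescaled and rounded requests. -/
def RESCALE (A : OnlineAlg) (k : ℕ) : AdviceAlg where
  State := (s : List ℝ) × (DIVIDE A k (rescaleN s)).State
  init s := do
    let st ← (DIVIDE A k (rescaleN s)).init (s.map (rescaleServer s))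
    pure ⟨s, st⟩
  step st x := do
    let res ← (DIVIDE A k (rescaleN st.1)).step st.2 (rescaleRequest st.1 x)
    pure (res.1, ⟨st.1, res.2⟩)

end

/-!
By an exchange argument the matching in the order of the positions is optimal. In this matching the
requests of a block that are served from blocks further right are the rightmost ones of the block,
and those served from blocks further left are the leftmost ones, so two positions and four numbers
per block describe them. LR, told the direction of every marked request, serves the marked requests
at no more than their cost in the monotone matching, again by an exchange argument. The unmarked
requests of a block, with the unmarked servers of the block, form an input for `A` of size at most
`⌈n / k⌉`, on which the monotone matching is one of the perfect matchings that `OPT` competes with.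
As `OPT` is a lower bound for every algorithm and unbounded on the inputs of each size, `c ≥ 1`, so
the marked requests are absorbed into `c(⌈n / k⌉) · OPT`; `A` contributes its additive constant once
per block.

The requests keep their relative order under RESCALE, and up to an additive error of `1` per request
all distances are scaled by `n³`. Dividing by `n³` turns the additive constants and the rounding
errors, multiplied by `c(⌈n / k⌉) = O(n²)`, into `O(1)`, while the largest position stays polynomial
in `n` and `s_n - s_1`.
-/

noncomputable section

namespace AdviceProg

/-- Some advice word of length at most `m` makes the program return `b`, whatever follows that word
on the tape: the notion by which an oracle assembles its tape from the words for the single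
instructions. -/
def Yields {β : Type} (p : AdviceProg β) (b : β) (m : ℕ) : Prop :=
  ∃ l : List Bool, l.length ≤ m ∧ ∀ φ : Stream' Bool, p.run (l ++ₛ φ) = (b, l.length)

theorem yields_pure {β : Type} (b : β) : Yields (pure b) b 0 :=
  ⟨[], le_rfl, fun _ => rfl⟩

theorem Yields.mono {β : Type} {p : AdviceProg β} {b : β} {m m' : ℕ} (h : Yields p b m)
    (hm : m ≤ m') : Yields p b m' :=
  let ⟨l, hl, hrun⟩ := h
  ⟨l, hl.trans hm, hrun⟩

theorem Yields.exists_run {β : Type} {p : AdviceProg β} {b : β} {m : ℕ} (h : Yields p b m) :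
    ∃ φ : ℕ → Bool, (p.run φ).1 = b ∧ (p.run φ).2 ≤ m := by
  obtain ⟨l, hl, hrun⟩ := h
  refine ⟨l ++ₛ Stream'.const false, ?_⟩
  rw [hrun]
  exact ⟨rfl, hl⟩

theorem run_read_append {β : Type} (next : Bool → AdviceProg β) (bit : Bool) (l : List Bool)
    (φ : Stream' Bool) :
    (read next).run ((bit :: l) ++ₛ φ) =
      (((next bit).run (l ++ₛ φ)).1, ((next bit).run (l ++ₛ φ)).2 + 1) :=
  rfl

theorem Yields.read {β : Type} {next : Bool → AdviceProg β} {bit : Bool} {b : β} {m : ℕ}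
    (h : Yields (next bit) b m) : Yields (.read next) b (m + 1) := by
  obtain ⟨l, hl, hrun⟩ := h
  refine ⟨bit :: l, by simpa using hl, fun φ => ?_⟩
  rw [run_read_append, hrun, List.length_cons]

theorem Yields.bind {β γ : Type} {p : AdviceProg β} {f : β → AdviceProg γ} {b : β} {c : γ}
    {m m' : ℕ} (hp : Yields p b m) (hf : Yields (f b) c m') : Yields (p >>= f) c (m + m') := by
  obtain ⟨l, hl, hrun⟩ := hp
  induction p generalizing l m with
  | ret b' =>
    have hb : (b', 0) = (b, l.length) := hrun (Stream'.const false)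
    obtain ⟨rfl, -⟩ := Prod.mk.inj hb
    exact hf.mono (Nat.le_add_left m' m)
  | read next ih =>
    cases l with
    | nil => exact absurd (congrArg Prod.snd (hrun (Stream'.const false))) (Nat.succ_ne_zero _)
    | cons bit l =>
      obtain ⟨m, rfl⟩ := Nat.exists_eq_add_of_lt hl
      rw [List.length_cons] at hl
      have hnext : Yields (next bit >>= f) c (l.length + m + m') := by
        refine ih bit l (Nat.le_add_right _ _) fun φ => ?_
        have hφ := hrun φ
        rw [run_read_append, Prod.mk.injEq, List.length_cons, Nat.add_right_cancel_iff] at hφ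
        exact Prod.ext hφ.1 hφ.2
      exact (Yields.read (next := fun bit => next bit >>= f) hnext).mono (by lia)

theorem Yields.map {β γ : Type} {p : AdviceProg β} {b : β} {m : ℕ} (hp : Yields p b m)
    (g : β → γ) : Yields (p >>= fun b => pure (g b)) (g b) m :=
  hp.bind (f := fun b => pure (g b)) (yields_pure (g b))

theorem run_bind_of_eq_pure {β γ : Type} {p : AdviceProg β} {f : β → AdviceProg γ}
    {φ : ℕ → Bool} {c : γ} (hf : f (p.run φ).1 = pure c) : (p >>= f).run φ = (c, (p.run φ).2) := by
  induction p generalizing φ with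
  | ret b =>
    change (f b).run φ = _
    rw [show f b = pure c from hf]
    rfl
  | read next ih =>
    change (AdviceProg.read fun bit => next bit >>= f).run φ = _
    simp only [run, ih _ hf]

theorem run_bind_pure {β γ : Type} (p : AdviceProg β) (g : β → γ) (φ : ℕ → Bool) :
    (p >>= fun b => pure (g b)).run φ = (g (p.run φ).1, (p.run φ).2) :=
  run_bind_of_eq_pure rfl

theorem yields_readWord {w v : ℕ} (hv : v < 2 ^ w) : Yields (readWord w) v w := by
  induction w generalizing v with
  | zero =>
    obtain rfl : v = 0 := by simpa using hv
    exact yields_pure 0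
  | succ w ih =>
    obtain ⟨bit, hbit⟩ : ∃ bit : Bool, bit.toNat = v / 2 ^ w := by
      have hdiv : v / 2 ^ w < 2 := Nat.div_lt_of_lt_mul (by rwa [pow_succ] at hv)
      interval_cases v / 2 ^ w
      exacts [⟨false, rfl⟩, ⟨true, rfl⟩]
    have hmod := (ih (Nat.mod_lt v (Nat.two_pow_pos w))).map fun u => bit.toNat * 2 ^ w + u
    rw [hbit, Nat.div_add_mod'] at hmod
    exact Yields.read (next := fun bit => do
      let u ← readWord w
      pure (bit.toNat * 2 ^ w + u)) (hbit ▸ hmod)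

theorem yields_readWord_option {w e : ℕ} (he : e < 2 ^ w) {q : Option ℕ}
    (hq : ∀ v ∈ q, v < 2 ^ w ∧ v ≠ e) :
    Yields (do let u ← readWord w; pure (if u = e then none else some u)) q w := by
  cases q with
  | none => simpa using (yields_readWord he).map fun u => if u = e then none else some u
  | some v =>
    obtain ⟨hv, hve⟩ := hq v rfl
    simpa [hve] using (yields_readWord hv).map fun u => if u = e then none else some u

theorem yields_forIndices {β : Type} {b₀ : β} {f : ℕ → AdviceProg β} {g : ℕ → β} {m : ℕ}
    {is : List ℕ} (hf : ∀ i ∈ is, Yields (f i) (g i) m) (hg : ∀ i ∉ is, g i = b₀) :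
    Yields (forIndices b₀ f is) g (is.length * m) := by
  classical
  suffices H : Yields (forIndices b₀ f is) (fun i => if i ∈ is then g i else b₀)
      (is.length * m) by
    convert H using 2 with i
    split_ifs with hi
    exacts [rfl, hg i hi]
  clear hg
  induction is with
  | nil => simpa [forIndices] using yields_pure fun _ : ℕ => b₀
  | cons i is ih =>
    have hrest := (ih fun j hj => hf j (List.mem_cons_of_mem i hj)).map
      fun g' => Function.update g' i (g i)
    have hupdate : Function.update (fun j => if j ∈ is then g j else b₀) i (g i) =
        fun j => if j ∈ i :: is then g j else b₀ := by
      ext j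
      by_cases hj : j = i
      · subst hj; simp
      · simp [hj]
    rw [hupdate] at hrest
    exact ((hf i List.mem_cons_self).bind hrest).mono (by rw [List.length_cons]; lia)

/-- The instruction by which `divideRead` reads `d` and `m` for a block in which the position of the
outermost request served from one side is `q`. -/
def readPair (v : ℕ) : Option ℕ → AdviceProg (ℕ × ℕ)
  | none => pure (0, 0)
  | some _ => do
    let d ← readWord v
    let m ← readWord v
    pure (d, m)

theorem yields_readPair {v d m : ℕ} {q : Option ℕ} (hq : q = none → d = 0 ∧ m = 0)
    (hd : d < 2 ^ v) (hm : m < 2 ^ v) : Yields (readPair v q) (d, m) (2 * v) := by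
  cases q with
  | none =>
    obtain ⟨rfl, rfl⟩ := hq rfl
    exact (yields_pure _).mono (Nat.zero_le _)
  | some q =>
    rw [two_mul]
    exact (yields_readWord hd).bind ((yields_readWord hm).map fun m => (d, m))

end AdviceProg

/-- The conditions under which the words on the tape can encode the values of `D`. -/
structure DivideSetup.IsReadable (D : DivideSetup) : Prop where
  qL_bounds : ∀ i, ∀ q ∈ D.qL i, (1 < i ∧ i ≤ D.k) ∧ 0 < q ∧ q ≤ D.N
  qR_bounds : ∀ i, ∀ q ∈ D.qR i, (0 < i ∧ i < D.k) ∧ q < D.N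
  left_eq_zero : ∀ i, D.qL i = none → D.dL i = 0 ∧ D.mL i = 0
  right_eq_zero : ∀ i, D.qR i = none → D.dR i = 0 ∧ D.mR i = 0
  dL_le : ∀ i, D.dL i ≤ D.n
  mL_le : ∀ i, D.mL i ≤ D.n
  dR_le : ∀ i, D.dR i ≤ D.n
  mR_le : ∀ i, D.mR i ≤ D.n

open AdviceProg

theorem DivideSetup.IsReadable.yields_divideRead {D : DivideSetup} (h : D.IsReadable) :
    Yields (divideRead D.k D.N D.servers) D
      ((D.k - 1) * (2 * Nat.size D.N + 4 * Nat.size D.n)) := by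
  have hN : D.N < 2 ^ Nat.size D.N := Nat.lt_size_self D.N
  have hn {d : ℕ} (hd : d ≤ D.n) : d < 2 ^ Nat.size D.n := hd.trans_lt (Nat.lt_size_self D.n)
  have hqL : ∀ i ∉ List.Ico 2 (D.k + 1), D.qL i = none := fun i hi =>
    Option.eq_none_iff_forall_not_mem.2 fun q hq => by
      have := h.qL_bounds i q hq
      rw [List.Ico.mem] at hi
      lia
  have hqR : ∀ i ∉ List.Ico 1 D.k, D.qR i = none := fun i hi =>
    Option.eq_none_iff_forall_not_mem.2 fun q hq => by
      have := h.qR_bounds i q hq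
      rw [List.Ico.mem] at hi
      lia
  have readL : Yields _ D.qL _ := yields_forIndices
    (fun i _ => yields_readWord_option (Nat.two_pow_pos (Nat.size D.N)) fun q hq => by
      have := h.qL_bounds i q hq
      lia) hqL
  have readR : Yields _ D.qR _ := yields_forIndices
    (fun i _ => yields_readWord_option (w := Nat.size D.N) (Nat.sub_one_lt (by lia)) fun q hq => by
      have := h.qR_bounds i q hq
      lia) hqR
  have readPairsR := yields_forIndices (b₀ := (0, 0)) (is := List.Ico 1 D.k)
    (f := fun i => readPair (Nat.size D.n) (D.qR i)) (g := fun i => (D.dR i, D.mR i))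
    (fun i _ => yields_readPair (h.right_eq_zero i) (hn (h.dR_le i)) (hn (h.mR_le i)))
    fun i hi => Prod.ext_iff.2 (h.right_eq_zero i (hqR i hi))
  have readPairsL := yields_forIndices (b₀ := (0, 0)) (is := (List.Ico 2 (D.k + 1)).reverse)
    (f := fun i => readPair (Nat.size D.n) (D.qL i)) (g := fun i => (D.dL i, D.mL i))
    (fun i _ => yields_readPair (h.left_eq_zero i) (hn (h.dL_le i)) (hn (h.mL_le i)))
    fun i hi => Prod.ext_iff.2 (h.left_eq_zero i (hqL i (by rwa [List.mem_reverse] at hi)))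
  refine Yields.mono (readL.bind (readR.bind (readPairsR.bind (readPairsL.map _)))) ?_
  simp only [List.Ico.length, List.length_reverse, Nat.add_sub_add_right (m := 1)]
  lia

/-! ### Exchanging the partners of a matching -/

section Exchange

variable {ι α : Type*} [DecidableEq α] {s : Finset ι} {f g : ι → α} {W : ι → α → ℝ}

theorem sum_swap_comp_le {a : ι} {q : α} (ha : a ∈ s) (hg : Set.InjOn g s)
    (hpair : ∀ b ∈ s, g b = q → W a q + W b (g a) ≤ W a (g a) + W b q)
    (hfree : (∀ b ∈ s, g b ≠ q) → W a q ≤ W a (g a)) :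
    ∑ i ∈ s, W i (Equiv.swap (g a) q (g i)) ≤ ∑ i ∈ s, W i (g i) := by
  classical
  have hfix {i : ι} (hi : i ∈ s) (hia : i ≠ a) (hiq : g i ≠ q) :
      Equiv.swap (g a) q (g i) = g i :=
    Equiv.swap_apply_of_ne_of_ne (fun h => hia (hg hi ha h)) hiq
  by_cases hq : ∃ b ∈ s, g b = q
  · obtain ⟨b, hb, rfl⟩ := hq
    obtain rfl | hba := eq_or_ne b a
    · simp
    have hb' : b ∈ s.erase a := Finset.mem_erase.2 ⟨hba, hb⟩
    have hrest : ∀ i ∈ (s.erase a).erase b, W i (Equiv.swap (g a) (g b) (g i)) = W i (g i) := by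
      intro i hi
      simp only [Finset.mem_erase] at hi
      rw [hfix hi.2.2 hi.2.1 fun h => hi.1 (hg hi.2.2 hb h)]
    simp only [← Finset.add_sum_erase s _ ha, ← Finset.add_sum_erase _ _ hb',
      Finset.sum_congr rfl hrest, Equiv.swap_apply_left, Equiv.swap_apply_right]
    linarith [hpair b hb rfl]
  · push Not at hq
    have hrest : ∀ i ∈ s.erase a, W i (Equiv.swap (g a) q (g i)) = W i (g i) := by
      intro i hi
      rw [Finset.mem_erase] at hi
      rw [hfix hi.2 hi.1 (hq i hi.2)]
    simp only [← Finset.add_sum_erase s _ ha, Finset.sum_congr rfl hrest, Equiv.swap_apply_left]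
    linarith [hfree hq]

theorem sum_swap_comp_le_of_monge [LinearOrder α] (hf : Set.InjOn f s) (hg : Set.InjOn g s)
    (hgf : ∀ i ∈ s, g i ∈ s.image f)
    (hW : ∀ i ∈ s, ∀ i' ∈ s, ∀ j ∈ s.image f, ∀ j' ∈ s.image f, f i < f i' → j < j' →
      W i j + W i' j' ≤ W i j' + W i' j)
    {a : ι} (ha : a ∈ s) (hmax : ∀ i ∈ s, f i ≤ f a) :
    ∑ i ∈ s, W i (Equiv.swap (g a) (f a) (g i)) ≤ ∑ i ∈ s, W i (g i) := by
  have hmax' : ∀ j ∈ s.image f, j ≤ f a := by simpa using hmax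
  have hsurj : f a ∈ s.image g :=
    Finset.eq_of_subset_of_card_le (Finset.image_subset_iff.2 hgf)
      (by rw [Finset.card_image_of_injOn hf, Finset.card_image_of_injOn hg]) ▸
      Finset.mem_image_of_mem f ha
  refine sum_swap_comp_le ha hg (fun b hb hba => ?_) fun hne => ?_
  · obtain rfl | hab := eq_or_ne b a
    · rw [hba]
    have hga : g a < f a := (hmax' _ (hgf a ha)).lt_of_ne fun h => hab (hg hb ha (hba.trans h.symm))
    have hfb : f b < f a := (hmax b hb).lt_of_ne fun h => hab (hf hb ha h)
    linarith [hW b hb a ha _ (hgf a ha) _ (Finset.mem_image_of_mem f ha) hfb hga]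
  · obtain ⟨b, hb, hba⟩ := Finset.mem_image.1 hsurj
    exact absurd hba (hne b hb)

theorem sum_le_sum_of_monge [LinearOrder α] (hf : Set.InjOn f s) (hg : Set.InjOn g s)
    (hgf : ∀ i ∈ s, g i ∈ s.image f)
    (hW : ∀ i ∈ s, ∀ i' ∈ s, ∀ j ∈ s.image f, ∀ j' ∈ s.image f, f i < f i' → j < j' →
      W i j + W i' j' ≤ W i j' + W i' j) :
    ∑ i ∈ s, W i (f i) ≤ ∑ i ∈ s, W i (g i) := by
  classical
  induction s using Finset.induction_on_max_value f generalizing g with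
  | empty => simp
  | insert a s ha hmax ih =>
    have ha' : a ∈ insert a s := s.mem_insert_self a
    have himage : (insert a s).image f = insert (f a) (s.image f) := s.image_insert f a
    set g' : ι → α := fun i => Equiv.swap (g a) (f a) (g i)
    have hg' : Set.InjOn g' ↑(insert a s) :=
      fun i hi j hj h => hg hi hj ((Equiv.swap _ _).injective h)
    have hg'a : g' a = f a := Equiv.swap_apply_left _ _
    have hg'f : ∀ i ∈ s, g' i ∈ s.image f := fun i hi => by
      have hmem : g' i ∈ (insert a s).image f := by
        simp only [g', Equiv.swap_apply_def]
        split_ifs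
        exacts [Finset.mem_image_of_mem f ha', hgf a ha', hgf i (Finset.mem_insert_of_mem hi)]
      refine (Finset.mem_insert.1 (himage ▸ hmem)).resolve_left fun h => ha ?_
      rwa [← hg' (Finset.mem_insert_of_mem hi) ha' (h.trans hg'a.symm)]
    have hrest : ∑ i ∈ s, W i (f i) ≤ ∑ i ∈ s, W i (g' i) := by
      refine ih (hf.mono (by simp)) (hg'.mono (by simp)) hg'f fun i hi i' hi' j hj j' hj' => ?_
      exact hW i (Finset.mem_insert_of_mem hi) i' (Finset.mem_insert_of_mem hi')
        j (by simp [himage, hj]) j' (by simp [himage, hj'])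
    calc ∑ i ∈ insert a s, W i (f i) ≤ ∑ i ∈ insert a s, W i (g' i) := by
          rw [Finset.sum_insert ha, Finset.sum_insert ha, hg'a]
          gcongr
      _ ≤ ∑ i ∈ insert a s, W i (g i) :=
          sum_swap_comp_le_of_monge hf hg hgf hW ha' (by simpa using hmax)

end Exchange

/-! ### LR on requests with prescribed directions -/

theorem lrStep_run (st : List (ℕ × ℝ)) (y : ℝ) (φ : ℕ → Bool) :
    ((lrStep st y).run φ).1 =
      (((lrChoose st y).run φ).1, st.filter fun p => p.1 ≠ ((lrChoose st y).run φ).1) := by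
  rw [lrStep, AdviceProg.run_bind_pure]

theorem mem_lrInit {s : List ℝ} {p : ℕ × ℝ} :
    p ∈ lrInit s ↔ p.1 < s.length ∧ p.2 = s.getD p.1 0 := by
  rcases p with ⟨j, v⟩
  simp only [lrInit, List.mem_map, Prod.exists, Prod.swap_prod_mk, Prod.mk.injEq,
    List.mem_zipIdx_iff_getElem?, List.getElem?_eq_some_iff]
  constructor
  · rintro ⟨_, _, ⟨hj, hv⟩, rfl, rfl⟩
    exact ⟨hj, by rw [List.getD_eq_getElem s 0 hj, hv]⟩
  · rintro ⟨hj, rfl⟩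
    exact ⟨_, j, ⟨hj, (List.getD_eq_getElem s 0 hj).symm⟩, rfl, rfl⟩

theorem pairwise_lrInit {s : List ℝ} (hs : s.Pairwise (· ≤ ·)) :
    (lrInit s).Pairwise fun p q => p.2 ≤ q.2 := by
  have h : ((lrInit s).map Prod.snd).Pairwise (· ≤ ·) := by
    simpa [lrInit, Function.comp_def] using hs
  exact List.pairwise_map.1 h

section Choose

variable {st : List (ℕ × ℝ)} {y : ℝ} {p₀ : ℕ × ℝ}

theorem exists_lrChoose_right (hst : st.Pairwise fun p q => p.2 ≤ q.2) (hp₀ : p₀ ∈ st)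
    (hy : y ≤ p₀.2) :
    ∃ p ∈ st, ((lrChoose st y).run fun _ => true).1 = p.1 ∧ p.2 ∈ Set.uIcc y p₀.2 := by
  simp only [Set.uIcc_of_le hy]
  unfold lrChoose
  cases hat : st.filter fun p => p.2 = y with
  | cons p l =>
    have hp : p ∈ st.filter fun p => p.2 = y := hat ▸ List.mem_cons_self
    rw [List.mem_filter, decide_eq_true_eq] at hp
    exact ⟨p, hp.1, rfl, hp.2.ge, hp.2.trans_le hy⟩
  | nil =>
    have hp₀' : p₀ ∈ st.filter fun p => y < p.2 := by
      simp only [List.filter_eq_nil_iff, decide_eq_true_eq] at hat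
      simp [hp₀, lt_of_le_of_ne hy (Ne.symm (hat p₀ hp₀))]
    cases hafter : st.filter fun p => y < p.2 with
    | nil => simp [hafter] at hp₀'
    | cons q l =>
      have hq : q ∈ st.filter fun p => y < p.2 := hafter ▸ List.mem_cons_self
      have hsorted := hst.filter fun p => y < p.2
      rw [hafter, List.pairwise_cons] at hsorted
      rw [hafter, List.mem_cons] at hp₀'
      rw [List.mem_filter, decide_eq_true_eq] at hq
      refine ⟨q, hq.1, ?_, hq.2.le, ?_⟩
      · cases (st.filter fun p => p.2 < y).getLast? <;> rfl
      · rcases hp₀' with rfl | hp₀'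
        exacts [le_rfl, hsorted.1 p₀ hp₀']

theorem exists_lrChoose_left (hst : st.Pairwise fun p q => p.2 ≤ q.2) (hp₀ : p₀ ∈ st)
    (hy : p₀.2 ≤ y) :
    ∃ p ∈ st, ((lrChoose st y).run fun _ => false).1 = p.1 ∧ p.2 ∈ Set.uIcc y p₀.2 := by
  simp only [Set.uIcc_of_ge hy]
  unfold lrChoose
  cases hat : st.filter fun p => p.2 = y with
  | cons p l =>
    have hp : p ∈ st.filter fun p => p.2 = y := hat ▸ List.mem_cons_self
    rw [List.mem_filter, decide_eq_true_eq] at hp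
    exact ⟨p, hp.1, rfl, hy.trans_eq hp.2.symm, hp.2.le⟩
  | nil =>
    have hp₀' : p₀ ∈ st.filter fun p => p.2 < y := by
      simp only [List.filter_eq_nil_iff, decide_eq_true_eq] at hat
      simp [hp₀, lt_of_le_of_ne hy (hat p₀ hp₀)]
    obtain hbefore | ⟨l, q, hbefore⟩ := List.eq_nil_or_concat' (st.filter fun p => p.2 < y)
    · simp [hbefore] at hp₀'
    · have hq : q ∈ st.filter fun p => p.2 < y := by simp [hbefore]
      have hsorted := hst.filter fun p => p.2 < y
      rw [hbefore, List.pairwise_append] at hsorted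
      rw [hbefore, List.mem_append, List.mem_singleton] at hp₀'
      rw [List.mem_filter, decide_eq_true_eq] at hq
      refine ⟨q, hq.1, ?_, ?_, hq.2.le⟩
      · rw [hbefore, List.getLast?_concat]
        cases (st.filter fun p => y < p.2).head? <;> rfl
      · rcases hp₀' with hp₀' | rfl
        exacts [hsorted.2.2 p₀ hp₀' q List.mem_cons_self, le_rfl]

end Choose

/-- The marks `M` agree with an assignment of requests at the positions `x` to servers at the
positions `v`: requests marked to the right are served from the right, those marked to the left from
the left, and where a request marked to the right lies left of one marked to the left, their paths
do not cross.  This is the invariant of the exchange argument for LR. -/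
structure RespectsMarks {ι : Type*} (M : ι → Mark) (x v : ι → ℝ) (s : Finset ι) : Prop where
  right : ∀ b ∈ s, M b = .right → x b ≤ v b
  left : ∀ b ∈ s, M b = .left → v b < x b
  cross : ∀ b ∈ s, ∀ c ∈ s, M b = .right → M c = .left → v b ≤ v c ∨ x c ≤ x b

namespace RespectsMarks

variable {ι : Type*} {M : ι → Mark} {x v v' : ι → ℝ} {s t : Finset ι} {a : ι}

/-- When `a` takes a server between itself and its own server from another request, that request
takes over the server of `a`. -/
theorem exchange (h : RespectsMarks M x v s) (ha : a ∈ s) (hM : M a ≠ .unmarked) (hts : t ⊆ s)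
    (horder : M a = .left → ∀ b ∈ t, M b = .right → x a ≠ x b)
    (hv' : ∀ b ∈ t, v' b = v b ∨ v b ∈ Set.uIcc (x a) (v a) ∧ v' b = v a) :
    RespectsMarks M x v' t := by
  cases hMa : M a with
  | unmarked => exact absurd hMa hM
  | right =>
    have hxa := h.right a ha hMa
    rw [Set.uIcc_of_le hxa] at hv'
    refine ⟨fun b hb hMb => ?_, fun b hb hMb => ?_, fun b hb c hc hMb hMc => ?_⟩
    · have := h.right b (hts hb) hMb
      grind
    · have := h.left b (hts hb) hMb
      have := h.cross a ha b (hts hb) hMa hMb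
      grind
    · have := h.left c (hts hc) hMc
      have := h.cross b (hts hb) c (hts hc) hMb hMc
      have := h.cross a ha c (hts hc) hMa hMc
      grind
  | left =>
    have hxa := h.left a ha hMa
    rw [Set.uIcc_of_ge hxa.le] at hv'
    refine ⟨fun b hb hMb => ?_, fun b hb hMb => ?_, fun b hb c hc hMb hMc => ?_⟩
    · have := h.right b (hts hb) hMb
      have := h.cross b (hts hb) a ha hMb hMa
      have := horder hMa b hb hMb
      grind
    · have := h.left b (hts hb) hMb
      grind
    · have := h.right b (hts hb) hMb
      have := horder hMa b hb hMb
      have := h.cross b (hts hb) c (hts hc) hMb hMc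
      have := h.cross b (hts hb) a ha hMb hMa
      grind

end RespectsMarks

theorem dist_exchange_le {y v w : ℝ} (hw : w ∈ Set.uIcc y v) (z : ℝ) :
    |y - w| + |z - v| ≤ |y - v| + |z - w| := by
  have hdist := dist_add_dist_of_mem_segment ((segment_eq_uIcc y v).symm ▸ hw)
  rw [Real.dist_eq, Real.dist_eq, Real.dist_eq] at hdist
  linarith [abs_sub_le z w v]

/-- The bit that a mark puts on the tape of LR. -/
def Mark.lrBit : Mark → Bool
  | .right => true
  | _ => false

/-- The state of LR on the servers `s` before request `a`, when LR serves the marked requests only,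
with its bits given by the marks. -/
def markedLRState (M : ℕ → Mark) (x : ℕ → ℝ) (s : List ℝ) : ℕ → List (ℕ × ℝ)
  | 0 => lrInit s
  | a + 1 => match M a with
    | .unmarked => markedLRState M x s a
    | m => ((lrStep (markedLRState M x s a) (x a)).run fun _ => m.lrBit).1.2

/-- The answer of LR to the marked request `a`. -/
def markedLRAnswer (M : ℕ → Mark) (x : ℕ → ℝ) (s : List ℝ) (a : ℕ) : ℕ :=
  ((lrChoose (markedLRState M x s a) (x a)).run fun _ => (M a).lrBit).1

open Classical in
/-- The marked requests with indices from `a` to `n - 1`. -/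
def markedFrom (M : ℕ → Mark) (n a : ℕ) : Finset ℕ :=
  (Finset.Ico a n).filter fun b => M b ≠ .unmarked

section MarkedLR

variable {M : ℕ → Mark} {x : ℕ → ℝ} {s : List ℝ} {n a : ℕ}

theorem mem_markedFrom {b : ℕ} : b ∈ markedFrom M n a ↔ (a ≤ b ∧ b < n) ∧ M b ≠ .unmarked := by
  simp [markedFrom]

theorem markedFrom_of_unmarked (h : M a = .unmarked) :
    markedFrom M n a = markedFrom M n (a + 1) := by
  ext b
  simp only [mem_markedFrom]
  grind

theorem markedFrom_of_marked (han : a < n) (h : M a ≠ .unmarked) :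
    markedFrom M n a = insert a (markedFrom M n (a + 1)) := by
  ext b
  simp only [mem_markedFrom, Finset.mem_insert]
  grind

theorem notMem_markedFrom_succ : a ∉ markedFrom M n (a + 1) := by
  simp [mem_markedFrom]

theorem markedLRState_succ_of_unmarked (h : M a = .unmarked) :
    markedLRState M x s (a + 1) = markedLRState M x s a := by
  simp only [markedLRState, h]

theorem markedLRState_succ_of_marked (h : M a ≠ .unmarked) :
    markedLRState M x s (a + 1) =
      (markedLRState M x s a).filter fun p => p.1 ≠ markedLRAnswer M x s a := by
  cases hM : M a
  · exact absurd hM h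
  all_goals simp only [markedLRState, markedLRAnswer, hM, lrStep_run]

theorem markedLRState_sublist : ∀ a, (markedLRState M x s a).Sublist (lrInit s)
  | 0 => List.Sublist.refl _
  | a + 1 => by
    by_cases h : M a = .unmarked
    · rw [markedLRState_succ_of_unmarked h]
      exact markedLRState_sublist a
    · rw [markedLRState_succ_of_marked h]
      exact List.filter_sublist.trans (markedLRState_sublist a)

/-- An assignment `τ` of the marked requests from `a` on to servers that are still unmatched when LR
serves request `a`, in agreement with the marks. -/
structure IsLRPlan (M : ℕ → Mark) (x : ℕ → ℝ) (s : List ℝ) (n : ℕ) (τ : ℕ → ℕ) (a : ℕ) : Prop where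
  unmatched : ∀ b ∈ markedFrom M n a, (τ b, s.getD (τ b) 0) ∈ markedLRState M x s a
  injOn : Set.InjOn τ (markedFrom M n a)
  respectsMarks : RespectsMarks M x (fun b => s.getD (τ b) 0) (markedFrom M n a)

namespace IsLRPlan

variable {τ : ℕ → ℕ}

theorem exists_markedLRAnswer (h : IsLRPlan M x s n τ a) (hs : s.Pairwise (· ≤ ·))
    (han : a < n) (hM : M a ≠ .unmarked) :
    (markedLRAnswer M x s a, s.getD (markedLRAnswer M x s a) 0) ∈ markedLRState M x s a ∧
      s.getD (markedLRAnswer M x s a) 0 ∈ Set.uIcc (x a) (s.getD (τ a) 0) := by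
  have ha : a ∈ markedFrom M n a := mem_markedFrom.2 ⟨⟨le_rfl, han⟩, hM⟩
  have hsorted := (pairwise_lrInit hs).sublist (markedLRState_sublist (M := M) (x := x) a)
  obtain ⟨p, hp, hans, hmem⟩ : ∃ p ∈ markedLRState M x s a, markedLRAnswer M x s a = p.1 ∧
      p.2 ∈ Set.uIcc (x a) (s.getD (τ a) 0) := by
    unfold markedLRAnswer
    cases hMa : M a with
    | unmarked => exact absurd hMa hM
    | right =>
      exact exists_lrChoose_right hsorted (h.unmatched a ha) (h.respectsMarks.right a ha hMa)
    | left =>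
      exact exists_lrChoose_left hsorted (h.unmatched a ha) (h.respectsMarks.left a ha hMa).le
  have hp₂ := (mem_lrInit.1 ((markedLRState_sublist a).subset hp)).2
  rw [hans, ← hp₂]
  exact ⟨hp, hmem⟩

theorem succ_of_unmarked (h : IsLRPlan M x s n τ a) (hM : M a = .unmarked) :
    IsLRPlan M x s n τ (a + 1) := by
  obtain ⟨hunmatched, hinj, hmarks⟩ := h
  rw [markedFrom_of_unmarked hM] at hunmatched hinj hmarks
  exact ⟨by rwa [markedLRState_succ_of_unmarked hM], hinj, hmarks⟩

theorem succ_of_marked (h : IsLRPlan M x s n τ a) (hs : s.Pairwise (· ≤ ·)) (han : a < n)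
    (hM : M a ≠ .unmarked)
    (horder : M a = .left → ∀ c, a < c → c < n → M c = .right → x a ≠ x c) :
    IsLRPlan M x s n (fun b => Equiv.swap (τ a) (markedLRAnswer M x s a) (τ b)) (a + 1) := by
  have hq := (h.exists_markedLRAnswer hs han hM).2
  have ha : a ∈ markedFrom M n a := mem_markedFrom.2 ⟨⟨le_rfl, han⟩, hM⟩
  have hsub : markedFrom M n (a + 1) ⊆ markedFrom M n a := fun b hb => by
    rw [mem_markedFrom] at hb ⊢
    grind
  have hne {b : ℕ} (hb : b ∈ markedFrom M n (a + 1)) : τ b ≠ τ a := fun hba =>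
    notMem_markedFrom_succ (h.injOn (hsub hb) ha hba ▸ hb)
  have hswap {b : ℕ} (hb : b ∈ markedFrom M n (a + 1)) :=
    Equiv.swap_apply_of_ne_of_ne (b := markedLRAnswer M x s a) (hne hb)
  refine ⟨fun b hb => ?_, fun b hb c hc hbc => h.injOn (hsub hb) (hsub hc)
    ((Equiv.swap _ _).injective hbc), ?_⟩
  · rw [markedLRState_succ_of_marked hM, List.mem_filter, decide_eq_true_eq]
    refine ⟨?_, ?_⟩
    · rcases eq_or_ne (τ b) (markedLRAnswer M x s a) with hbq | hbq
      · rw [hbq, Equiv.swap_apply_right]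
        exact h.unmatched a ha
      · rw [hswap hb hbq]
        exact h.unmatched b (hsub hb)
    · rw [Ne, Equiv.swap_apply_eq_iff, Equiv.swap_apply_right]
      exact hne hb
  · refine h.respectsMarks.exchange ha hM hsub (fun hMa c hc => ?_) fun b hb => ?_
    · rw [mem_markedFrom] at hc
      exact horder hMa c hc.1.1 hc.1.2
    · rcases eq_or_ne (τ b) (markedLRAnswer M x s a) with hbq | hbq
      · exact Or.inr ⟨hbq ▸ hq, by simp only [hbq, Equiv.swap_apply_right]⟩
      · exact Or.inl (by simp only [hswap hb hbq])

theorem cost_succ_le (h : IsLRPlan M x s n τ a) (hs : s.Pairwise (· ≤ ·)) (han : a < n)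
    (hM : M a ≠ .unmarked) :
    |x a - s.getD (markedLRAnswer M x s a) 0| + ∑ b ∈ markedFrom M n (a + 1),
        |x b - s.getD (Equiv.swap (τ a) (markedLRAnswer M x s a) (τ b)) 0| ≤
      ∑ b ∈ markedFrom M n a, |x b - s.getD (τ b) 0| := by
  have hq := (h.exists_markedLRAnswer hs han hM).2
  have hsum := sum_swap_comp_le (W := fun b j => |x b - s.getD j 0|) (q := markedLRAnswer M x s a)
    (mem_markedFrom.2 ⟨⟨le_rfl, han⟩, hM⟩) h.injOn
    (fun b _ _ => dist_exchange_le hq (x b))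
    (fun _ => by
      have := dist_exchange_le hq (s.getD (markedLRAnswer M x s a) 0)
      rw [sub_self, abs_zero, add_zero] at this
      exact (le_add_of_nonneg_right (abs_nonneg _)).trans this)
  rw [markedFrom_of_marked han hM] at hsum ⊢
  rwa [Finset.sum_insert notMem_markedFrom_succ, Equiv.swap_apply_left] at hsum

theorem markedLRAnswer_optimal (h : IsLRPlan M x s n τ a) (hs : s.Pairwise (· ≤ ·)) (han : a ≤ n)
    (horder : ∀ b c, b < c → c < n → M b = .left → M c = .right → x b ≠ x c) :
    (∀ b ∈ markedFrom M n a,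
      (markedLRAnswer M x s b, s.getD (markedLRAnswer M x s b) 0) ∈ markedLRState M x s a) ∧
    Set.InjOn (markedLRAnswer M x s) (markedFrom M n a) ∧
    ∑ b ∈ markedFrom M n a, |x b - s.getD (markedLRAnswer M x s b) 0| ≤
      ∑ b ∈ markedFrom M n a, |x b - s.getD (τ b) 0| := by
  induction han using Nat.decreasingInduction generalizing τ with
  | self => simp [markedFrom]
  | of_succ a han ih =>
    by_cases hM : M a = .unmarked
    · have := ih (h.succ_of_unmarked hM)
      rwa [← markedFrom_of_unmarked hM, markedLRState_succ_of_unmarked hM] at this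
    · obtain ⟨hunmatched, hinj, hcost⟩ := ih (h.succ_of_marked hs han hM
        fun hMa c hac hcn => horder a c hac hcn hMa)
      rw [markedLRState_succ_of_marked hM] at hunmatched
      simp only [List.mem_filter, decide_eq_true_eq] at hunmatched
      refine ⟨?_, ?_, ?_⟩
      · rw [markedFrom_of_marked han hM, Finset.forall_mem_insert]
        exact ⟨(h.exists_markedLRAnswer hs han hM).1, fun b hb => (hunmatched b hb).1⟩
      · rw [markedFrom_of_marked han hM, Finset.coe_insert, Set.injOn_insert notMem_markedFrom_succ]
        refine ⟨hinj, ?_⟩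
        rintro ⟨b, hb, hba⟩
        exact (hunmatched b hb).2 hba
      · refine le_trans ?_ (h.cost_succ_le hs han hM)
        rw [markedFrom_of_marked han hM, Finset.sum_insert notMem_markedFrom_succ]
        gcongr

end IsLRPlan

end MarkedLR

/-! ### The monotone matching -/

/-- Requests `0, …, n - 1` with positions and blocks, and as many servers, listed in increasing
order; the servers of the `i`-th block end before server `serverEnd i`. -/
structure BlockSystem where
  n : ℕ
  k : ℕ
  pos : ℕ → ℕ
  block : ℕ → ℕ
  serverEnd : ℕ → ℕ
  serverEnd_mono : Monotone serverEnd
  serverEnd_zero : serverEnd 0 = 0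
  serverEnd_last : serverEnd k = n
  one_le_block : ∀ a < n, 1 ≤ block a
  block_le : ∀ a < n, block a ≤ k
  block_mono : ∀ a < n, ∀ b < n, pos a ≤ pos b → block a ≤ block b

namespace BlockSystem

variable (S : BlockSystem)

/-- The number of requests at positions below `y`. -/
def numBelow (y : ℕ) : ℕ := ((Finset.range S.n).filter fun b => S.pos b < y).card

/-- The number of requests before request `a` at the position of `a`. -/
def numEarlier (a : ℕ) : ℕ := ((Finset.range a).filter fun b => S.pos b = S.pos a).card

/-- The number of requests in the first `i` blocks. -/
def numUpTo (i : ℕ) : ℕ := ((Finset.range S.n).filter fun b => S.block b ≤ i).card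

/-- The requests at the position of `a` get the servers from `numBelow (pos a)` to
`numBelow (pos a + 1)`; those before `cutL a` belong to earlier blocks. -/
def cutL (a : ℕ) : ℕ :=
  max (S.numBelow (S.pos a)) (min (S.numBelow (S.pos a + 1)) (S.serverEnd (S.block a - 1)))

/-- Of the servers of the requests at the position of `a`, those from `cutR a` on belong to later
blocks. -/
def cutR (a : ℕ) : ℕ :=
  max (S.numBelow (S.pos a)) (min (S.numBelow (S.pos a + 1)) (S.serverEnd (S.block a)))

/-- The number of requests at the position of `a` that are served in their own block. -/
def numStay (a : ℕ) : ℕ := S.cutR a - S.cutL a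

/-- The number of requests at the position of `a` that are not served from the left. -/
def numNotLeft (a : ℕ) : ℕ := S.numBelow (S.pos a + 1) - S.cutL a

/-- The requests of block `i` get the servers from `numUpTo (i - 1)` to `numUpTo i`; this is the
number of those served from the right, that is, by a server of a later block. -/
def numRight (i : ℕ) : ℕ := S.numUpTo i - max (S.serverEnd i) (S.numUpTo (i - 1))

/-- The number of requests of block `i` that are served from the left, that is, by a server of an
earlier block. -/
def numLeft (i : ℕ) : ℕ := min (S.numUpTo i) (S.serverEnd (i - 1)) - S.numUpTo (i - 1)

/-- The server of request `a` in the monotone matching in which, among the requests at one position,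
first those arrive that stay in their block, then those served from the right, then those served
from the left. -/
def server (a : ℕ) : ℕ :=
  if S.numEarlier a < S.numNotLeft a then S.cutL a + S.numEarlier a
  else S.numBelow (S.pos a) + (S.numEarlier a - S.numNotLeft a)

/-- The side from which request `a` is served in the monotone matching, or `unmarked` if it is
served in its own block. -/
def mark (a : ℕ) : Mark :=
  if S.numEarlier a < S.numStay a then .unmarked
  else if S.numEarlier a < S.numNotLeft a then .right else .left

variable {S} {a b i : ℕ}

theorem numBelow_mono : Monotone S.numBelow := fun _ _ h =>
  Finset.card_le_card (Finset.monotone_filter_right _ fun _ _ hb => lt_of_lt_of_le hb h)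

theorem numBelow_le (y : ℕ) : S.numBelow y ≤ S.n :=
  (Finset.card_filter_le _ _).trans_eq (Finset.card_range _)

theorem numUpTo_le (i : ℕ) : S.numUpTo i ≤ S.n :=
  (Finset.card_filter_le _ _).trans_eq (Finset.card_range _)

theorem numStay_le_numNotLeft (a : ℕ) : S.numStay a ≤ S.numNotLeft a := by
  have := S.numBelow_mono (Nat.le_succ (S.pos a))
  unfold numStay numNotLeft cutR
  lia

theorem numNotLeft_le (a : ℕ) : S.numNotLeft a ≤ S.n :=
  (Nat.sub_le _ _).trans (numBelow_le _)

theorem numRight_le (i : ℕ) : S.numRight i ≤ S.n := (Nat.sub_le _ _).trans (numUpTo_le _)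

theorem numLeft_le (i : ℕ) : S.numLeft i ≤ S.n :=
  (Nat.sub_le _ _).trans (min_le_left _ _ |>.trans (numUpTo_le _))

theorem numBelow_add_numEarlier_lt (ha : a < S.n) :
    S.numBelow (S.pos a) + S.numEarlier a < S.numBelow (S.pos a + 1) := by
  rw [numBelow, numEarlier, ← Finset.card_union_of_disjoint]
  · refine Finset.card_lt_card (Finset.ssubset_iff_of_subset ?_ |>.2 ⟨a, ?_, ?_⟩)
    · grind
    · simp [ha]
    · simp
  · exact Finset.disjoint_left.2 fun b hb hb' => by
      simp only [Finset.mem_filter] at hb hb'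
      lia

theorem numEarlier_lt (hab : a < b) (h : S.pos a = S.pos b) : S.numEarlier a < S.numEarlier b := by
  refine Finset.card_lt_card (Finset.ssubset_iff_of_subset ?_ |>.2 ⟨a, ?_, ?_⟩)
  · grind
  · simp [hab, h]
  · simp

theorem numBelow_le_server (ha : a < S.n) : S.numBelow (S.pos a) ≤ S.server a := by
  have := S.numBelow_add_numEarlier_lt ha
  unfold server cutL
  split_ifs <;> lia

theorem server_lt_numBelow (ha : a < S.n) : S.server a < S.numBelow (S.pos a + 1) := by
  have := S.numBelow_add_numEarlier_lt ha
  unfold server numNotLeft cutL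
  split_ifs <;> lia

theorem server_lt (ha : a < S.n) : S.server a < S.n :=
  (server_lt_numBelow ha).trans_le (numBelow_le _)

theorem server_lt_server (ha : a < S.n) (hb : b < S.n) (hab : S.pos a < S.pos b) :
    S.server a < S.server b :=
  (server_lt_numBelow ha).trans_le ((numBelow_mono hab).trans (numBelow_le_server hb))

theorem pos_le_of_server_lt (ha : a < S.n) (hb : b < S.n) (hab : S.server a < S.server b) :
    S.pos a ≤ S.pos b :=
  not_lt.1 fun hba => hab.not_gt (server_lt_server hb ha hba)

theorem block_eq (ha : a < S.n) (hb : b < S.n) (hab : S.pos a = S.pos b) : S.block a = S.block b :=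
  le_antisymm (S.block_mono a ha b hb hab.le) (S.block_mono b hb a ha hab.ge)

theorem cutL_eq (ha : a < S.n) (hb : b < S.n) (hab : S.pos a = S.pos b) : S.cutL a = S.cutL b := by
  rw [cutL, cutL, block_eq ha hb hab, hab]

theorem numStay_eq (ha : a < S.n) (hb : b < S.n) (hab : S.pos a = S.pos b) :
    S.numStay a = S.numStay b := by
  rw [numStay, numStay, cutL_eq ha hb hab, cutR, cutR, block_eq ha hb hab, hab]

theorem numNotLeft_eq (ha : a < S.n) (hb : b < S.n) (hab : S.pos a = S.pos b) :
    S.numNotLeft a = S.numNotLeft b := by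
  rw [numNotLeft, numNotLeft, cutL_eq ha hb hab, hab]

theorem server_injOn : Set.InjOn S.server (Finset.range S.n) := by
  have hlater : ∀ a < S.n, ∀ b < S.n, a < b → S.pos a = S.pos b → S.server a ≠ S.server b := by
    intro a ha b hb hab hpos
    have hearlier := numEarlier_lt hab hpos
    have hb' := numBelow_add_numEarlier_lt hb
    rw [server, server, numNotLeft_eq ha hb hpos, numNotLeft, cutL_eq ha hb hpos, cutL, hpos]
    split_ifs <;> lia
  intro a ha b hb hab
  rw [Finset.coe_range, Set.mem_Iio] at ha hb
  rcases lt_trichotomy (S.pos a) (S.pos b) with hpos | hpos | hpos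
  · exact absurd hab (server_lt_server ha hb hpos).ne
  · by_contra hne
    rcases lt_or_gt_of_ne hne with hlt | hlt
    exacts [hlater a ha b hb hlt hpos hab, hlater b hb a ha hlt hpos.symm hab.symm]
  · exact absurd hab (server_lt_server hb ha hpos).ne'

theorem image_server : (Finset.range S.n).image S.server = Finset.range S.n :=
  Finset.eq_of_subset_of_card_le
    (Finset.image_subset_iff.2 fun _ ha => Finset.mem_range.2 (server_lt (Finset.mem_range.1 ha)))
    (Finset.card_image_of_injOn server_injOn).ge

theorem mark_eq (ha : a < S.n) :
    S.mark a = if S.server a < S.serverEnd (S.block a - 1) then .left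
      else if S.server a < S.serverEnd (S.block a) then .unmarked else .right := by
  have hearlier := numBelow_add_numEarlier_lt ha
  have hend : S.serverEnd (S.block a - 1) ≤ S.serverEnd (S.block a) := S.serverEnd_mono (by lia)
  unfold mark server numStay numNotLeft cutL cutR
  split_ifs <;> first | rfl | lia

theorem mark_eq_left_iff (ha : a < S.n) :
    S.mark a = .left ↔ S.server a < S.serverEnd (S.block a - 1) := by
  grind [mark_eq ha]

theorem mark_eq_right_iff (ha : a < S.n) :
    S.mark a = .right ↔ S.serverEnd (S.block a) ≤ S.server a := by
  have hend : S.serverEnd (S.block a - 1) ≤ S.serverEnd (S.block a) := S.serverEnd_mono (by lia)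
  grind [mark_eq ha]

theorem mark_eq_unmarked_iff (ha : a < S.n) :
    S.mark a = .unmarked ↔
      S.serverEnd (S.block a - 1) ≤ S.server a ∧ S.server a < S.serverEnd (S.block a) := by
  grind [mark_eq ha]

theorem pos_ne_of_left_of_right (hab : a < b) (hb : b < S.n) (hl : S.mark a = .left)
    (hr : S.mark b = .right) : S.pos a ≠ S.pos b := fun hpos => by
  have hearlier := numEarlier_lt hab hpos
  rw [mark, numStay_eq (hab.trans hb) hb hpos, numNotLeft_eq (hab.trans hb) hb hpos] at hl
  rw [mark] at hr
  grind

theorem server_lt_numUpTo_iff (ha : a < S.n) : S.server a < S.numUpTo i ↔ S.block a ≤ i := by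
  constructor
  · contrapose!
    refine fun hi => le_trans (Finset.card_le_card fun b hb => ?_) (numBelow_le_server ha)
    simp only [Finset.mem_filter, Finset.mem_range] at hb ⊢
    exact ⟨hb.1, not_le.1 fun hpos => by linarith [S.block_mono a ha b hb.1 hpos]⟩
  · refine fun hi => (server_lt_numBelow ha).trans_le (Finset.card_le_card fun b hb => ?_)
    simp only [Finset.mem_filter, Finset.mem_range] at hb ⊢
    exact ⟨hb.1, (S.block_mono b hb.1 a ha (by lia)).trans hi⟩

theorem exists_server_eq {j : ℕ} (hj : j < S.n) : ∃ a < S.n, S.server a = j := by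
  have hj' := Finset.mem_range.2 hj
  rw [← image_server, Finset.mem_image] at hj'
  simpa only [Finset.mem_range] using hj'

theorem block_lt_of_mark_eq_right (ha : a < S.n) (hr : S.mark a = .right) : S.block a < S.k := by
  rw [mark_eq_right_iff ha] at hr
  by_contra hk
  have := S.serverEnd_mono (not_lt.1 hk)
  have := server_lt ha
  have := S.serverEnd_last
  lia

theorem one_lt_block_of_mark_eq_left (ha : a < S.n) (hl : S.mark a = .left) : 1 < S.block a := by
  rw [mark_eq_left_iff ha] at hl
  by_contra hk
  rw [Nat.sub_eq_zero_of_le (not_lt.1 hk), S.serverEnd_zero] at hl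
  lia

theorem mark_eq_right_of_pos_lt (ha : a < S.n) (hb : b < S.n) (hblock : S.block a = S.block b)
    (hpos : S.pos a < S.pos b) (hr : S.mark a = .right) : S.mark b = .right := by
  rw [mark_eq_right_iff ha, hblock] at hr
  exact (mark_eq_right_iff hb).2 (hr.trans (server_lt_server ha hb hpos).le)

theorem mark_eq_left_of_lt_pos (ha : a < S.n) (hb : b < S.n) (hblock : S.block a = S.block b)
    (hpos : S.pos b < S.pos a) (hl : S.mark a = .left) : S.mark b = .left := by
  rw [mark_eq_left_iff ha, hblock] at hl
  exact (mark_eq_left_iff hb).2 ((server_lt_server hb ha hpos).trans hl)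

theorem exists_right_of_numRight_ne_zero (h : S.numRight i ≠ 0) :
    ∃ a < S.n, S.block a = i ∧ S.mark a = .right := by
  unfold numRight at h
  have := S.numUpTo_le i
  obtain ⟨a, ha, hserver⟩ :=
    S.exists_server_eq (j := max (S.serverEnd i) (S.numUpTo (i - 1))) (by lia)
  have hle : S.block a ≤ i := (server_lt_numUpTo_iff ha).1 (by lia)
  have hge : ¬S.block a ≤ i - 1 := (server_lt_numUpTo_iff ha).not.1 (by lia)
  obtain rfl : S.block a = i := by lia
  exact ⟨a, ha, rfl, (mark_eq_right_iff ha).2 (hserver ▸ le_max_left _ _)⟩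

theorem exists_left_of_numLeft_ne_zero (h : S.numLeft i ≠ 0) :
    ∃ a < S.n, S.block a = i ∧ S.mark a = .left := by
  unfold numLeft at h
  have := S.numUpTo_le i
  obtain ⟨a, ha, hserver⟩ := S.exists_server_eq (j := S.numUpTo (i - 1)) (by lia)
  have hle : S.block a ≤ i := (server_lt_numUpTo_iff ha).1 (by lia)
  have hge : ¬S.block a ≤ i - 1 := (server_lt_numUpTo_iff ha).not.1 (by lia)
  obtain rfl : S.block a = i := by lia
  exact ⟨a, ha, rfl, (mark_eq_left_iff ha).2 (by lia)⟩

/-- `q` and `d` are the advice words about the requests of block `i` with mark `m`: `q` is the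
position of such a request, extremal with respect to `closer`, and `d` is the value of `num` there.
-/
structure IsWord (S : BlockSystem) (m : Mark) (closer : ℕ → ℕ → Prop) (num : ℕ → ℕ) (i : ℕ)
    (q : Option ℕ) (d : ℕ) : Prop where
  attained : ∀ y ∈ q, ∃ a < S.n, S.block a = i ∧ S.mark a = m ∧ S.pos a = y ∧ d = num a
  bound : ∀ a < S.n, S.block a = i → S.mark a = m → ∃ y ∈ q, closer y (S.pos a)
  eq_zero : q = none → d = 0

theorem exists_isWord {closer : ℕ → ℕ → Prop} (m : Mark) (num : ℕ → ℕ) (i : ℕ)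
    (hcloser : ∀ t : Finset ℕ, t.Nonempty → ∃ a ∈ t, ∀ b ∈ t, closer (S.pos a) (S.pos b)) :
    ∃ qd : Option ℕ × ℕ, S.IsWord m closer num i qd.1 qd.2 := by
  classical
  rcases ((Finset.range S.n).filter fun a => S.block a = i ∧ S.mark a = m).eq_empty_or_nonempty
    with hnone | hsome
  · refine ⟨(none, 0), by simp, fun a ha hblock hmark => absurd hnone ?_, fun _ => rfl⟩
    exact Finset.ne_empty_of_mem (Finset.mem_filter.2 ⟨Finset.mem_range.2 ha, hblock, hmark⟩)
  · obtain ⟨a, ha, hclosest⟩ := hcloser _ hsome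
    simp only [Finset.mem_filter, Finset.mem_range, and_imp] at ha hclosest
    exact ⟨(some (S.pos a), num a),
      fun y hy => ⟨a, ha.1, ha.2.1, ha.2.2, Option.mem_some.1 hy, rfl⟩,
      fun b hb hblock hmark => ⟨_, rfl, hclosest b hb hblock hmark⟩, by simp⟩

theorem IsWord.eq_num {m : Mark} {closer : ℕ → ℕ → Prop} {num : ℕ → ℕ} {q : Option ℕ} {d : ℕ}
    (h : S.IsWord m closer num i q d) (hnum : ∀ b < S.n, S.pos b = S.pos a → num b = num a)
    (hq : q = some (S.pos a)) : d = num a := by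
  obtain ⟨b, hb, -, -, hpos, hd⟩ := h.attained _ hq
  exact hd.trans (hnum b hb hpos)

theorem IsWord.le_of_num_le {m : Mark} {closer : ℕ → ℕ → Prop} {num : ℕ → ℕ} {q : Option ℕ}
    {d : ℕ} (h : S.IsWord m closer num i q d) (hnum : ∀ a, num a ≤ S.n) : d ≤ S.n := by
  cases hq : q with
  | none => exact (h.eq_zero hq).trans_le (Nat.zero_le _)
  | some y =>
    obtain ⟨a, -, -, -, -, rfl⟩ := h.attained y hq
    exact hnum a

end BlockSystem

/-! ### Blocks and positions -/

theorem ceilDiv_eq_div_add {n k : ℕ} (hk : 1 ≤ k) :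
    n ⌈/⌉ k = n / k + if n % k = 0 then 0 else 1 := by
  have hdiv := Nat.div_add_mod n k
  have hmod := Nat.mod_lt n hk
  rw [Nat.ceilDiv_eq_add_pred_div, Nat.div_eq_iff hk]
  split_ifs <;> grind

theorem blockEnd_eq {n k : ℕ} (hk : 1 ≤ k) (i : ℕ) :
    blockEnd n k i = i * (n / k) + min i (n % k) := by
  unfold blockEnd
  rw [ceilDiv_eq_div_add hk]
  rcases le_or_gt i (n % k) with hi | hi
  · rw [if_pos hi, min_eq_left hi]
    split_ifs with h
    · obtain rfl : i = 0 := by lia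
      simp
    · ring
  · obtain ⟨d, rfl⟩ := Nat.exists_eq_add_of_le hi.le
    rw [if_neg hi.not_ge, min_eq_right hi.le, Nat.add_sub_cancel_left]
    split_ifs with h
    · simp [h]
    · ring

theorem blockEnd_mono {n k : ℕ} (hk : 1 ≤ k) : Monotone (blockEnd n k) := by
  intro i j hij
  rw [blockEnd_eq hk, blockEnd_eq hk]
  gcongr

theorem blockEnd_zero (n k : ℕ) : blockEnd n k 0 = 0 := by simp [blockEnd]

theorem blockEnd_last {n k : ℕ} (hk : 1 ≤ k) : blockEnd n k k = n := by
  rw [blockEnd_eq hk, min_eq_right (Nat.mod_lt n hk).le, Nat.div_add_mod]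

theorem blockEnd_lt_succ {n k : ℕ} (hk : 1 ≤ k) (hkn : k ≤ n) (i : ℕ) :
    blockEnd n k i < blockEnd n k (i + 1) := by
  have := Nat.div_pos hkn hk
  rw [blockEnd_eq hk, blockEnd_eq hk, Nat.add_one_mul]
  lia

theorem blockEnd_sub_le {n k : ℕ} (hk : 1 ≤ k) (i : ℕ) :
    blockEnd n k i - blockEnd n k (i - 1) ≤ n ⌈/⌉ k := by
  rcases i with _ | i
  · simp
  · rw [blockEnd_eq hk, blockEnd_eq hk, ceilDiv_eq_div_add hk, Nat.add_sub_cancel, Nat.add_one_mul]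
    split_ifs <;> lia

/-- The input of DIVIDE: servers in `[1, N - 1]` and integer requests `x 0, x 1, …`. -/
structure IsDivideInput (D : DivideSetup) (x : ℕ → ℝ) : Prop where
  sorted : D.servers.Pairwise (· ≤ ·)
  one_le : ∀ v ∈ D.servers, 1 ≤ v
  le_N : ∀ v ∈ D.servers, v + 1 ≤ D.N
  int : ∀ a, ∃ z : ℤ, x a = z
  one_le_k : 1 ≤ D.k
  k_le : D.k ≤ D.n

namespace DivideSetup

variable {D : DivideSetup}

theorem block_eq_card (y : ℝ) :
    D.block y = 1 + ((Finset.Ico 1 D.k).filter fun i => D.p i < y).card := rfl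

theorem one_le_block (y : ℝ) : 1 ≤ D.block y := Nat.le_add_right _ _

theorem block_mono : Monotone D.block := fun _ _ hyz => by
  rw [block_eq_card, block_eq_card]
  gcongr

theorem pos_mono : Monotone D.pos := fun _ _ hyz => Nat.floor_mono (min_le_min_right _ hyz)

/-- The position of the server with index `j`. -/
def serverPos (D : DivideSetup) (j : ℕ) : ℝ := D.servers.getD j 0

theorem serverPos_mem {j : ℕ} (hj : j < D.n) : D.serverPos j ∈ D.servers := by
  rw [serverPos, List.getD_eq_getElem _ _ hj]
  exact List.getElem_mem _

end DivideSetup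

namespace IsDivideInput

open DivideSetup

variable {D : DivideSetup} {x : ℕ → ℝ} {i j a b : ℕ} (h : IsDivideInput D x)

include h

theorem serverPos_mono (hij : i ≤ j) (hj : j < D.n) : D.serverPos i ≤ D.serverPos j := by
  rw [serverPos, serverPos, List.getD_eq_getElem _ _ hj, List.getD_eq_getElem _ _ (hij.trans_lt hj)]
  exact h.sorted.sortedLE.getElem_le_getElem_of_le hij

theorem one_le_serverPos (hj : j < D.n) : 1 ≤ D.serverPos j := h.one_le _ (serverPos_mem hj)

theorem serverPos_le (hj : j < D.n) : D.serverPos j + 1 ≤ D.N := h.le_N _ (serverPos_mem hj)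

theorem one_le_N : 1 ≤ D.N := by
  have hn : 0 < D.n := h.one_le_k.trans h.k_le
  have := h.one_le_serverPos hn
  have := h.serverPos_le hn
  exact_mod_cast (by linarith : (1 : ℝ) ≤ D.N)

theorem blockEnd_mem_Ico (hi : 1 ≤ i) (hik : i < D.k) :
    1 ≤ blockEnd D.n D.k i ∧ blockEnd D.n D.k i < D.n := by
  constructor
  · have := blockEnd_lt_succ h.one_le_k h.k_le (i - 1)
    rw [Nat.sub_add_cancel hi] at this
    lia
  · refine (blockEnd_lt_succ h.one_le_k h.k_le i).trans_le ?_
    exact (blockEnd_mono h.one_le_k hik).trans_eq (blockEnd_last h.one_le_k)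

theorem serverPos_le_p (hi : 1 ≤ i) (hik : i < D.k) (hj : j < blockEnd D.n D.k i) :
    D.serverPos j ≤ D.p i := by
  have hend := (h.blockEnd_mem_Ico hi hik).2
  have := h.serverPos_mono (Nat.le_sub_one_of_lt hj) (by lia)
  have := h.serverPos_mono hj.le hend
  unfold p serverPos at *
  linarith

theorem p_le_serverPos (hj : blockEnd D.n D.k i ≤ j) (hjn : j < D.n) :
    D.p i ≤ D.serverPos j := by
  have := h.serverPos_mono (show blockEnd D.n D.k i - 1 ≤ j by lia) hjn
  have := h.serverPos_mono hj hjn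
  unfold p serverPos at *
  linarith

theorem p_mono (hi : 1 ≤ i) (hij : i ≤ j) (hj : j < D.k) : D.p i ≤ D.p j := by
  rcases hij.eq_or_lt with rfl | hlt
  · exact le_rfl
  have hend := h.blockEnd_mem_Ico (hi.trans hij) hj
  have := blockEnd_lt_succ h.one_le_k h.k_le i
  have := blockEnd_mono h.one_le_k (n := D.n) (Nat.succ_le_of_lt hlt)
  exact (h.p_le_serverPos (Nat.le_sub_one_of_lt (by lia)) (by lia)).trans
    (h.serverPos_le_p (hi.trans hij) hj (Nat.sub_one_lt_of_lt hend.1))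

theorem one_le_p (hi : 1 ≤ i) (hik : i < D.k) : 1 ≤ D.p i :=
  have hend := h.blockEnd_mem_Ico hi hik
  (h.one_le_serverPos (hend.1.trans_lt hend.2 |>.trans' zero_lt_one)).trans
    (h.serverPos_le_p hi hik hend.1)

theorem p_lt_N (hi : 1 ≤ i) (hik : i < D.k) : D.p i < D.N := by
  have hend := h.blockEnd_mem_Ico hi hik
  linarith [h.p_le_serverPos le_rfl hend.2, h.serverPos_le hend.2]

theorem block_le (y : ℝ) : D.block y ≤ D.k := by
  have := Finset.card_filter_le (Finset.Ico 1 D.k) fun i => D.p i < y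
  rw [Nat.card_Ico] at this
  rw [block_eq_card]
  have := h.one_le_k
  lia

theorem block_le_iff (hi : 1 ≤ i) (hik : i < D.k) (y : ℝ) : D.block y ≤ i ↔ y ≤ D.p i := by
  rw [block_eq_card]
  constructor
  · contrapose!
    intro hlt
    have hsub : Finset.Ico 1 (i + 1) ⊆ (Finset.Ico 1 D.k).filter fun l => D.p l < y := by
      intro l hl
      simp only [Finset.mem_filter, Finset.mem_Ico] at hl ⊢
      exact ⟨⟨hl.1, by lia⟩, (h.p_mono hl.1 (by lia) hik).trans_lt hlt⟩
    have := Finset.card_le_card hsub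
    rw [Nat.card_Ico] at this
    lia
  · intro hle
    have hsub : (Finset.Ico 1 D.k).filter (fun l => D.p l < y) ⊆ Finset.Ico 1 i := by
      intro l hl
      simp only [Finset.mem_filter, Finset.mem_Ico] at hl ⊢
      exact ⟨hl.1.1, not_le.1 fun hil => (hl.2.trans_le hle).not_ge (h.p_mono hi hil hl.1.2)⟩
    have := Finset.card_le_card hsub
    rw [Nat.card_Ico] at this
    lia

theorem block_of_nonpos {y : ℝ} (hy : y ≤ 0) : D.block y = 1 := by
  rw [block_eq_card, Finset.filter_false_of_mem, Finset.card_empty]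
  intro i hi
  rw [Finset.mem_Ico] at hi
  linarith [h.one_le_p hi.1 hi.2]

theorem block_of_N_le {y : ℝ} (hy : D.N ≤ y) : D.block y = D.k := by
  rw [block_eq_card, Finset.filter_true_of_mem, Nat.card_Ico, Nat.add_sub_cancel' h.one_le_k]
  intro i hi
  rw [Finset.mem_Ico] at hi
  exact (h.p_lt_N hi.1 hi.2).trans_le hy

theorem outside_of_pos_le (hpos : D.pos (x b) ≤ D.pos (x a)) (hlt : x a < x b) :
    (x a ≤ 0 ∧ x b ≤ 0) ∨ ((D.N : ℝ) ≤ x a ∧ (D.N : ℝ) ≤ x b) := by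
  obtain ⟨u, hu⟩ := h.int a
  obtain ⟨v, hv⟩ := h.int b
  have hfloor : ∀ z : ℤ, D.pos z = (min z D.N).toNat := fun z => by
    rw [pos, ← Int.floor_toNat]
    exact_mod_cast congrArg Int.toNat (Int.floor_intCast (R := ℝ) (min z D.N))
  have := h.one_le_N
  rw [hu, hv, hfloor, hfloor] at hpos
  rw [hu, hv] at hlt ⊢
  norm_cast at hlt ⊢
  lia

theorem block_le_block_of_pos_le (hpos : D.pos (x a) ≤ D.pos (x b)) :
    D.block (x a) ≤ D.block (x b) := by
  rcases le_or_gt (x a) (x b) with hle | hlt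
  · exact block_mono hle
  · rcases h.outside_of_pos_le hpos hlt with ⟨hb, ha⟩ | ⟨hb, ha⟩
    · rw [h.block_of_nonpos ha, h.block_of_nonpos hb]
    · rw [h.block_of_N_le ha, h.block_of_N_le hb]

/-- The requests `x 0, …, x (n - 1)` with their cut off positions, and the blocks of DIVIDE. -/
def blockSystem : BlockSystem where
  n := D.n
  k := D.k
  pos a := D.pos (x a)
  block a := D.block (x a)
  serverEnd := blockEnd D.n D.k
  serverEnd_mono := blockEnd_mono h.one_le_k
  serverEnd_zero := blockEnd_zero _ _
  serverEnd_last := blockEnd_last h.one_le_k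
  one_le_block _ _ := one_le_block _
  block_le _ _ := h.block_le _
  block_mono _ _ _ _ hpos := h.block_le_block_of_pos_le hpos

theorem le_serverPos_of_mark_eq_right (ha : a < D.n) (hr : h.blockSystem.mark a = .right) :
    x a ≤ D.serverPos (h.blockSystem.server a) := by
  have hk : D.block (x a) < D.k := BlockSystem.block_lt_of_mark_eq_right (S := h.blockSystem) ha hr
  exact ((h.block_le_iff (one_le_block _) hk _).1 le_rfl).trans (h.p_le_serverPos
    ((BlockSystem.mark_eq_right_iff (S := h.blockSystem) ha).1 hr) (BlockSystem.server_lt ha))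

theorem serverPos_lt_of_mark_eq_left (ha : a < D.n) (hl : h.blockSystem.mark a = .left) :
    D.serverPos (h.blockSystem.server a) < x a := by
  have hblock : 1 < D.block (x a) :=
    BlockSystem.one_lt_block_of_mark_eq_left (S := h.blockSystem) ha hl
  have hk : D.block (x a) - 1 < D.k := by linarith [h.block_le (x a), Nat.sub_one_lt_of_lt hblock]
  refine (h.serverPos_le_p (Nat.le_sub_one_of_lt hblock) hk
    ((BlockSystem.mark_eq_left_iff (S := h.blockSystem) ha).1 hl)).trans_lt ?_
  exact not_le.1 fun hle =>
    absurd ((h.block_le_iff (Nat.le_sub_one_of_lt hblock) hk _).2 hle) (by lia)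

theorem eq_of_pos_eq (ha : a < D.n) (hb : b < D.n) (hpos : D.pos (x a) = D.pos (x b))
    (hr : h.blockSystem.mark a = .right) (hl : h.blockSystem.mark b = .left) : x a = x b := by
  have hak : D.block (x a) < D.k :=
    BlockSystem.block_lt_of_mark_eq_right (S := h.blockSystem) ha hr
  have hb1 : 1 < D.block (x b) :=
    BlockSystem.one_lt_block_of_mark_eq_left (S := h.blockSystem) hb hl
  have hinside : ¬((x a ≤ 0 ∧ x b ≤ 0) ∨ ((D.N : ℝ) ≤ x a ∧ (D.N : ℝ) ≤ x b)) := by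
    rintro (⟨-, hle⟩ | ⟨hge, -⟩)
    · exact hb1.ne' (h.block_of_nonpos hle)
    · exact hak.ne (h.block_of_N_le hge)
  rcases lt_trichotomy (x a) (x b) with hlt | heq | hlt
  · exact absurd (h.outside_of_pos_le hpos.ge hlt) hinside
  · exact heq
  · exact absurd (h.outside_of_pos_le hpos.le hlt) (by tauto)

end IsDivideInput

theorem abs_sub_add_abs_sub_le {a b s t : ℝ} (hab : a ≤ b) (hst : s ≤ t) :
    |a - s| + |b - t| ≤ |a - t| + |b - s| := by
  rcases abs_cases (a - s) with h₁ | h₁ <;> rcases abs_cases (b - t) with h₂ | h₂ <;>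
    rcases abs_cases (a - t) with h₃ | h₃ <;> rcases abs_cases (b - s) with h₄ | h₄ <;> linarith

theorem abs_sub_add_abs_sub_eq {a b s t : ℝ}
    (hout : (a ≤ min s t ∧ b ≤ min s t) ∨ (max s t ≤ a ∧ max s t ≤ b)) :
    |a - s| + |b - t| = |a - t| + |b - s| := by
  simp only [le_min_iff, max_le_iff] at hout
  rcases hout with ⟨⟨h₁, h₂⟩, h₃, h₄⟩ | ⟨⟨h₁, h₂⟩, h₃, h₄⟩
  · rw [abs_of_nonpos, abs_of_nonpos, abs_of_nonpos, abs_of_nonpos] <;> linarith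
  · rw [abs_of_nonneg, abs_of_nonneg, abs_of_nonneg, abs_of_nonneg] <;> linarith

theorem IsDivideInput.sum_server_le {D : DivideSetup} {x : ℕ → ℝ} (h : IsDivideInput D x)
    {m : ℕ → ℕ} (hm : ∀ a < D.n, m a < D.n) (hinj : Set.InjOn m (Finset.range D.n)) :
    ∑ a ∈ Finset.range D.n, |x a - D.serverPos (h.blockSystem.server a)| ≤
      ∑ a ∈ Finset.range D.n, |x a - D.serverPos (m a)| := by
  have himage : (Finset.range D.n).image h.blockSystem.server = Finset.range D.n :=
    BlockSystem.image_server (S := h.blockSystem)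
  refine sum_le_sum_of_monge (W := fun a j => |x a - D.serverPos j|)
    (BlockSystem.server_injOn (S := h.blockSystem)) hinj ?_ ?_
  · simpa only [himage, Finset.mem_range] using hm
  · simp only [himage, Finset.mem_range]
    intro a ha b hb i hi j hj hab hij
    rcases le_or_gt (x a) (x b) with hle | hlt
    · exact abs_sub_add_abs_sub_le hle (h.serverPos_mono hij.le hj)
    · have := h.one_le_serverPos hi
      have := h.one_le_serverPos hj
      have := h.serverPos_le hi
      have := h.serverPos_le hj
      have hpos : D.pos (x a) ≤ D.pos (x b) :=
        BlockSystem.pos_le_of_server_lt (S := h.blockSystem) ha hb hab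
      refine (abs_sub_add_abs_sub_eq ?_).le
      rcases h.outside_of_pos_le hpos hlt with ⟨-, hle⟩ | ⟨hge, -⟩
      · exact .inl ⟨le_min (by linarith) (by linarith), le_min (by linarith) (by linarith)⟩
      · exact .inr ⟨max_le (by linarith) (by linarith), max_le (by linarith) (by linarith)⟩

/-! ### The advice describing the monotone matching -/

theorem mem_take_filter_le_range {n g m j : ℕ} :
    j ∈ ((List.range n).filter fun j => g ≤ j).take m ↔ g ≤ j ∧ j < g + m ∧ j < n := by
  have hfilter : (List.range n).filter (fun j => g ≤ j) = List.range' g (n - g) := by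
    rw [← List.Ico.zero_bot, List.Ico.filter_le, Nat.zero_max, List.Ico]
  rw [hfilter]
  rcases le_total (n - g) m with hm | hm
  · rw [List.take_range'_of_length_le hm, List.mem_range'_1]
    lia
  · rw [List.take_range'_of_length_ge hm, List.mem_range'_1]
    lia

theorem mem_take_filter_reverse_range_lt {n g m j : ℕ} (hg : g ≤ n) :
    j ∈ ((List.range n).reverse.filter fun j => j < g).take m ↔ g - m ≤ j ∧ j < g := by
  have hfilter : (List.range n).filter (fun j => j < g) = List.range g := by
    rw [← List.Ico.zero_bot, List.Ico.filter_lt, List.Ico.zero_bot, min_eq_right hg]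
  rw [List.filter_reverse, hfilter, List.take_reverse, List.mem_reverse, List.length_range,
    List.range_eq_range', List.drop_range', List.mem_range'_1]
  lia

namespace BlockSystem

variable {S : BlockSystem} {a i : ℕ}

theorem server_mem_take_right (ha : a < S.n) {M : List ℕ} (hi : 1 ≤ i)
    (hM : ∀ b < S.n, S.server b ∈ M ↔ S.block b < i ∧ S.mark b = .right) :
    S.server a ∈ ((List.range S.n).filter fun j => S.serverEnd i ≤ j ∧ j ∉ M).take (S.numRight i) ↔
      S.block a = i ∧ S.mark a = .right := by
  have hfilter : ((List.range S.n).filter fun j => S.serverEnd i ≤ j ∧ j ∉ M) =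
      (List.range S.n).filter fun j => max (S.serverEnd i) (S.numUpTo (i - 1)) ≤ j := by
    refine List.filter_congr fun j hj => decide_eq_decide.2 ?_
    obtain ⟨b, hb, rfl⟩ := S.exists_server_eq (List.mem_range.1 hj)
    rw [hM b hb, mark_eq_right_iff hb, max_le_iff, ← not_lt (b := S.numUpTo _),
      server_lt_numUpTo_iff hb]
    refine and_congr_right fun hend => not_congr ⟨fun h => by lia, fun h => ⟨by lia, ?_⟩⟩
    exact (S.serverEnd_mono (by lia)).trans hend
  have hlt := server_lt_numUpTo_iff (i := i) ha
  have hlt' := server_lt_numUpTo_iff (i := i - 1) ha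
  have hn := server_lt ha
  rw [hfilter, mem_take_filter_le_range, mark_eq_right_iff ha, numRight]
  constructor
  · rintro ⟨hge, hle, -⟩
    obtain rfl : S.block a = i := by lia
    exact ⟨rfl, by lia⟩
  · rintro ⟨rfl, hge⟩
    lia

theorem server_mem_take_left (ha : a < S.n) {M : List ℕ} (hi : 1 ≤ i)
    (hM : ∀ b < S.n, S.server b ∈ M ↔ i < S.block b ∧ S.mark b = .left) :
    S.server a ∈ ((List.range S.n).reverse.filter fun j => j < S.serverEnd (i - 1) ∧ j ∉ M).take
        (S.numLeft i) ↔ S.block a = i ∧ S.mark a = .left := by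
  have hfilter : ((List.range S.n).reverse.filter fun j => j < S.serverEnd (i - 1) ∧ j ∉ M) =
      (List.range S.n).reverse.filter fun j => j < min (S.numUpTo i) (S.serverEnd (i - 1)) := by
    refine List.filter_congr fun j hj => decide_eq_decide.2 ?_
    obtain ⟨b, hb, rfl⟩ := S.exists_server_eq (List.mem_range.1 (List.mem_reverse.1 hj))
    rw [hM b hb, mark_eq_left_iff hb, lt_min_iff, server_lt_numUpTo_iff hb, and_comm]
    refine and_congr_left fun hend => ⟨fun h => ?_, fun h => by lia⟩
    by_contra hlt
    exact h ⟨not_le.1 hlt, hend.trans_le (S.serverEnd_mono (by lia))⟩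
  have hlt := server_lt_numUpTo_iff (i := i) ha
  have hlt' := server_lt_numUpTo_iff (i := i - 1) ha
  have hn := S.numUpTo_le i
  rw [hfilter, mem_take_filter_reverse_range_lt (by lia), mark_eq_left_iff ha, numLeft]
  constructor
  · rintro ⟨hge, hle⟩
    obtain rfl : S.block a = i := by lia
    exact ⟨rfl, by lia⟩
  · rintro ⟨rfl, hge⟩
    lia

end BlockSystem

namespace DivideSetup

/-- The mark that DIVIDE gives to request `a` of the sequence `x 0, x 1, …`. -/
def markAt (D : DivideSetup) (x : ℕ → ℝ) (a : ℕ) : Mark := D.mark ((List.range a).map x) (x a)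

/-- The words in `D` are the advice for the requests `x 0, …, x (n - 1)`, with respect to the
monotone matching. -/
structure IsAdvised (D : DivideSetup) (x : ℕ → ℝ) : Prop extends IsDivideInput D x where
  word_right : ∀ i, toIsDivideInput.blockSystem.IsWord .right (· ≤ ·)
    toIsDivideInput.blockSystem.numStay i (D.qR i) (D.dR i)
  word_left : ∀ i, toIsDivideInput.blockSystem.IsWord .left (· ≥ ·)
    toIsDivideInput.blockSystem.numNotLeft i (D.qL i) (D.dL i)
  mR_eq : ∀ i, D.mR i = toIsDivideInput.blockSystem.numRight i
  mL_eq : ∀ i, D.mL i = toIsDivideInput.blockSystem.numLeft i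

end DivideSetup

theorem IsDivideInput.exists_isAdvised {D : DivideSetup} {x : ℕ → ℝ} (h : IsDivideInput D x) :
    ∃ D' : DivideSetup, D'.servers = D.servers ∧ D'.k = D.k ∧ D'.N = D.N ∧ D'.IsAdvised x := by
  choose wR hwR using fun i => h.blockSystem.exists_isWord (closer := (· ≤ ·)) .right
    h.blockSystem.numStay i fun t ht => t.exists_min_image h.blockSystem.pos ht
  choose wL hwL using fun i => h.blockSystem.exists_isWord (closer := (· ≥ ·)) .left
    h.blockSystem.numNotLeft i fun t ht => t.exists_max_image h.blockSystem.pos ht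
  exact ⟨{ D with
      qR := fun i => (wR i).1, dR := fun i => (wR i).2, mR := h.blockSystem.numRight
      qL := fun i => (wL i).1, dL := fun i => (wL i).2, mL := h.blockSystem.numLeft },
    rfl, rfl, rfl, ⟨h.sorted, h.one_le, h.le_N, h.int, h.one_le_k, h.k_le⟩, hwR, hwL,
    fun _ => rfl, fun _ => rfl⟩

namespace DivideSetup.IsAdvised

open BlockSystem

variable {D : DivideSetup} {x : ℕ → ℝ} {a : ℕ} (h : IsAdvised D x)

include h

theorem isReadable : D.IsReadable where
  qL_bounds i q hq := by
    obtain ⟨a, ha, rfl, hl, rfl, -⟩ := (h.word_left i).attained q hq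
    have hpos : 1 ≤ x a := (h.one_le_serverPos (server_lt ha)).trans
      (h.serverPos_lt_of_mark_eq_left ha hl).le
    have hN : (1 : ℝ) ≤ D.N := by exact_mod_cast h.one_le_N
    exact ⟨⟨one_lt_block_of_mark_eq_left ha hl, h.blockSystem.block_le a ha⟩,
      Nat.floor_pos.2 (le_min hpos hN), Nat.floor_le_of_le (min_le_right _ _)⟩
  qR_bounds i q hq := by
    obtain ⟨a, ha, rfl, hr, rfl, -⟩ := (h.word_right i).attained q hq
    have hpos : x a < D.N := by
      linarith [h.le_serverPos_of_mark_eq_right ha hr, h.serverPos_le (server_lt ha)]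
    exact ⟨⟨h.blockSystem.one_le_block a ha, block_lt_of_mark_eq_right ha hr⟩,
      (Nat.floor_lt' (Nat.one_le_iff_ne_zero.1 h.one_le_N)).2 ((min_le_left _ _).trans_lt hpos)⟩
  left_eq_zero i hi := by
    refine ⟨(h.word_left i).eq_zero hi, by_contra fun hne => ?_⟩
    obtain ⟨a, ha, hblock, hl⟩ := exists_left_of_numLeft_ne_zero (h.mL_eq i ▸ hne)
    obtain ⟨y, hy, -⟩ := (h.word_left i).bound a ha hblock hl
    simp [hi] at hy
  right_eq_zero i hi := by
    refine ⟨(h.word_right i).eq_zero hi, by_contra fun hne => ?_⟩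
    obtain ⟨a, ha, hblock, hr⟩ := exists_right_of_numRight_ne_zero (h.mR_eq i ▸ hne)
    obtain ⟨y, hy, -⟩ := (h.word_right i).bound a ha hblock hr
    simp [hi] at hy
  dL_le i := (h.word_left i).le_of_num_le numNotLeft_le
  mL_le i := (h.mL_eq i).trans_le (numLeft_le i)
  dR_le i := (h.word_right i).le_of_num_le fun a =>
    (numStay_le_numNotLeft a).trans (numNotLeft_le a)
  mR_le i := (h.mR_eq i).trans_le (numRight_le i)

theorem markAt_eq (ha : a < D.n) : D.markAt x a = h.blockSystem.mark a := by
  set S := h.blockSystem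
  have hcount : (((List.range a).map x).filter fun z => D.pos z = D.pos (x a)).length =
      S.numEarlier a := by
    rw [List.filter_map, List.length_map]
    rfl
  have hright_of_lt : (∃ q, D.qR (D.block (x a)) = some q ∧ q < D.pos (x a)) →
      S.mark a = .right := by
    rintro ⟨q, hq, hlt⟩
    obtain ⟨b, hb, hblock, hr, rfl, -⟩ := (h.word_right _).attained q hq
    exact mark_eq_right_of_pos_lt hb ha hblock hlt hr
  have hleft_of_lt : (∃ q, D.qL (D.block (x a)) = some q ∧ D.pos (x a) < q) →
      S.mark a = .left := by
    rintro ⟨q, hq, hlt⟩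
    obtain ⟨b, hb, hblock, hl, rfl, -⟩ := (h.word_left _).attained q hq
    exact mark_eq_left_of_lt_pos hb ha hblock hlt hl
  have hdR : D.qR (D.block (x a)) = some (D.pos (x a)) → D.dR (D.block (x a)) = S.numStay a :=
    (h.word_right _).eq_num fun b hb => numStay_eq hb ha
  have hdL : D.qL (D.block (x a)) = some (D.pos (x a)) → D.dL (D.block (x a)) = S.numNotLeft a :=
    (h.word_left _).eq_num fun b hb => numNotLeft_eq hb ha
  have hright : S.mark a = .right → ∃ q, D.qR (D.block (x a)) = some q ∧ q ≤ D.pos (x a) :=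
    (h.word_right _).bound a ha rfl
  have hleft : S.mark a = .left → ∃ q, D.qL (D.block (x a)) = some q ∧ D.pos (x a) ≤ q :=
    (h.word_left _).bound a ha rfl
  have hle : S.numStay a ≤ S.numNotLeft a := numStay_le_numNotLeft a
  unfold markAt DivideSetup.mark
  simp only [hcount]
  have hmark := BlockSystem.mark.eq_def S a
  clear_value S
  split_ifs <;> grind

theorem server_mem_markedR_iff (ha : a < D.n) :
    h.blockSystem.server a ∈ D.markedR ↔ h.blockSystem.mark a = .right := by
  have hrounds : ∀ i, 1 ≤ i → ∀ a < D.n,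
      h.blockSystem.server a ∈ (List.Ico 1 i).foldl (fun M i => M ++
        ((List.range D.n).filter fun j => blockEnd D.n D.k i ≤ j ∧ j ∉ M).take (D.mR i)) [] ↔
      h.blockSystem.block a < i ∧ h.blockSystem.mark a = .right := by
    intro i hi
    induction i, hi using Nat.le_induction with
    | base =>
      intro a ha
      have hblock := h.blockSystem.one_le_block a ha
      simp [List.Ico.self_empty, Nat.one_le_iff_ne_zero.1 hblock]
    | succ i hi ih =>
      intro a ha
      rw [List.Ico.succ_top hi, List.foldl_append, List.foldl_cons, List.foldl_nil, h.mR_eq,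
        List.mem_append, ih a ha]
      refine (or_congr_right (server_mem_take_right (S := h.blockSystem) ha hi ih)).trans ?_
      rw [← or_and_right, Nat.lt_succ_iff_lt_or_eq]
  refine (hrounds D.k h.one_le_k a ha).trans (and_iff_right_of_imp fun hr => ?_)
  exact block_lt_of_mark_eq_right (S := h.blockSystem) ha hr

theorem server_mem_markedL_iff (ha : a < D.n) :
    h.blockSystem.server a ∈ D.markedL ↔ h.blockSystem.mark a = .left := by
  have hrounds : ∀ i ≤ D.k, ∀ a < D.n,
      h.blockSystem.server a ∈ (List.Ico (i + 1) (D.k + 1)).reverse.foldl (fun M i => M ++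
        ((List.range D.n).reverse.filter fun j =>
          j < blockEnd D.n D.k (i - 1) ∧ j ∉ M).take (D.mL i)) [] ↔
      i < h.blockSystem.block a ∧ h.blockSystem.mark a = .left := by
    intro i hi
    induction hi using Nat.decreasingInduction with
    | self =>
      intro a ha
      have hblock : ¬ D.k < h.blockSystem.block a := (h.blockSystem.block_le a ha).not_gt
      simp [List.Ico.self_empty, hblock]
    | of_succ i hi ih =>
      intro a ha
      rw [List.Ico.eq_cons (Nat.succ_lt_succ hi), List.reverse_cons, List.foldl_append,
        List.foldl_cons, List.foldl_nil, h.mL_eq, List.mem_append, ih a ha]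
      refine (or_congr_right (server_mem_take_left (S := h.blockSystem) ha (Nat.le_add_left 1 i)
        ih)).trans ?_
      rw [← or_and_right, eq_comm, ← Nat.le_iff_lt_or_eq, Nat.succ_le_iff]
  refine (hrounds 1 h.one_le_k a ha).trans (and_iff_right_of_imp fun hl => ?_)
  exact one_lt_block_of_mark_eq_left (S := h.blockSystem) ha hl

theorem server_mem_markedServers_iff (ha : a < D.n) :
    h.blockSystem.server a ∈ D.markedServers ↔ D.markAt x a ≠ .unmarked := by
  have hlt : h.blockSystem.server a < D.n := server_lt ha
  simp only [markedServers, List.mem_filter, List.mem_range, decide_eq_true_eq, hlt, true_and,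
    h.server_mem_markedR_iff ha, h.server_mem_markedL_iff ha, h.markAt_eq ha]
  cases h.blockSystem.mark a <;> simp

theorem server_mem_unmarkedServers_iff (ha : a < D.n) {i : ℕ} :
    h.blockSystem.server a ∈ D.unmarkedServers i ↔
      D.markAt x a = .unmarked ∧ D.block (x a) = i := by
  have hlt : h.blockSystem.server a < D.n := server_lt ha
  have hunmarked : h.blockSystem.mark a = .unmarked ↔
      blockEnd D.n D.k (D.block (x a) - 1) ≤ h.blockSystem.server a ∧
        h.blockSystem.server a < blockEnd D.n D.k (D.block (x a)) :=
    mark_eq_unmarked_iff (S := h.blockSystem) ha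
  simp only [unmarkedServers, List.mem_filter, List.mem_range, decide_eq_true_eq, hlt, true_and,
    h.server_mem_markedR_iff ha, h.server_mem_markedL_iff ha, h.markAt_eq ha]
  constructor
  · rintro ⟨hge, hend, hnr, hnl⟩
    have hm : h.blockSystem.mark a = .unmarked := by
      cases hm : h.blockSystem.mark a <;> simp_all
    have hown := hunmarked.1 hm
    have hmono := blockEnd_mono (n := D.n) h.one_le_k
    refine ⟨hm, le_antisymm ?_ ?_⟩ <;> by_contra! hne <;>
      linarith [hmono (Nat.le_sub_one_of_lt hne)]
  · rintro ⟨hm, rfl⟩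
    simpa [hm] using hunmarked.1 hm

end DivideSetup.IsAdvised

/-! ### Costs of matchings -/

theorem matchingCost_nonneg (s r : List ℝ) (m : List ℕ) : 0 ≤ matchingCost s r m := by
  refine List.sum_nonneg fun y hy => ?_
  rw [← List.map_uncurry_zip_eq_zipWith, List.mem_map] at hy
  obtain ⟨⟨z, j⟩, -, rfl⟩ := hy
  exact abs_nonneg _

theorem optCost_nonneg (s r : List ℝ) : 0 ≤ optCost s r :=
  Real.sInf_nonneg (Set.forall_mem_image.2 fun m _ => matchingCost_nonneg s r m)

theorem optCost_le {s : List ℝ} (r : List ℝ) {m : List ℕ} (hm : IsMatching s m) :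
    optCost s r ≤ matchingCost s r m :=
  csInf_le ⟨0, Set.forall_mem_image.2 fun m _ => matchingCost_nonneg s r m⟩ ⟨m, hm, rfl⟩

theorem le_optCost {s r : List ℝ} {v : ℝ} (h : ∀ m, IsMatching s m → v ≤ matchingCost s r m) :
    v ≤ optCost s r :=
  le_csInf (Set.Nonempty.image _ ⟨List.range s.length, List.Perm.refl _⟩)
    (Set.forall_mem_image.2 fun m hm => h m hm)

theorem matchingCost_map {α : Type*} (s : List ℝ) (l : List α) (x : α → ℝ) (f : α → ℕ) :
    matchingCost s (l.map x) (l.map f) = (l.map fun b => |x b - s.getD (f b) 0|).sum := by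
  simp [matchingCost]

theorem sum_map_filter_range (n : ℕ) (p : ℕ → Prop) [DecidablePred p] (g : ℕ → ℝ) :
    (((List.range n).filter fun b => p b).map g).sum = ∑ b ∈ Finset.range n with p b, g b := by
  rw [← List.sum_toFinset _ (List.nodup_range.filter _), List.toFinset_filter, List.toFinset_range]
  simp only [decide_eq_true_eq]

theorem sum_map_range (n : ℕ) (g : ℕ → ℝ) :
    ((List.range n).map g).sum = ∑ b ∈ Finset.range n, g b := by
  rw [← List.sum_toFinset _ List.nodup_range, List.toFinset_range]

theorem map_getD_range {α : Type*} (l : List α) (d : α) :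
    (List.range l.length).map (fun a => l.getD a d) = l :=
  List.ext_getElem (by simp) fun i _ hi => by simp [hi]

theorem map_idxOf_self {l : List ℕ} (hl : l.Nodup) :
    l.map (fun j => l.idxOf j) = List.range l.length := by
  refine List.ext_getElem (by simp) fun i hi _ => ?_
  rw [List.length_map] at hi
  simp [hl.idxOf_getElem i hi]

theorem getD_inj_of_nodup {l : List ℕ} (hl : l.Nodup) {i j : ℕ} (hi : i < l.length)
    (hj : j < l.length) (hij : l.getD i 0 = l.getD j 0) : i = j := by
  rwa [List.getD_eq_getElem _ _ hi, List.getD_eq_getElem _ _ hj, hl.getElem_inj_iff] at hij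

/-! ### The run of DIVIDE -/

theorem serve_filter (A : OnlineAlg) (s : List ℝ) (x : ℕ → ℝ) (p : ℕ → Prop)
    [DecidablePred p] (a m : ℕ) :
    A.serve s (((List.range a).filter fun b => p b).map x)
      (((List.range' a m).filter fun b => p b).map x) =
    ((List.range' a m).filter fun b => p b).map
      (fun b => A s (((List.range b).filter fun b => p b).map x) (x b)) := by
  induction m generalizing a with
  | zero => simp [OnlineAlg.serve]
  | succ m ih =>
    have ih := ih (a + 1)
    rw [List.range_succ, List.filter_append] at ih
    rw [List.range'_succ, List.filter_cons]
    by_cases ha : p a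
    · simp only [ha, decide_true, if_true, List.map_cons, OnlineAlg.serve, ← ih]
      simp [ha]
    · simp only [ha, decide_false, Bool.false_eq_true, if_false, ← ih]
      simp [ha]

namespace DivideSetup

variable (D : DivideSetup) (x : ℕ → ℝ)

open Classical in
/-- The unmarked requests of block `i` among the first `a` ones. -/
def unmarkedRequests (i a : ℕ) : List ℕ :=
  (List.range a).filter fun b => D.markAt x b = .unmarked ∧ D.block (x b) = i

/-- The servers on which `A` is run in block `i`. -/
def blockServers (i : ℕ) : List ℝ := D.positions (D.unmarkedServers i)

/-- The input of `A` in block `i` that arrives before the request `a`. -/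
def blockRequests (i a : ℕ) : List ℝ := (D.unmarkedRequests x i a).map x

/-- The answer of `A`, run on its block, to the unmarked request `a`. -/
def blockAnswer (A : OnlineAlg) (a : ℕ) : ℕ :=
  A (D.blockServers (D.block (x a))) (D.blockRequests x (D.block (x a)) a) (x a)

/-- The answer of LR, run on the marked servers and requests, to the marked request `a`. -/
def lrAnswer (a : ℕ) : ℕ := markedLRAnswer (D.markAt x) x (D.positions D.markedServers) a

/-- The server that DIVIDE uses for the request `a`. -/
def answer (A : OnlineAlg) (a : ℕ) : ℕ :=
  match D.markAt x a with
  | .unmarked => (D.unmarkedServers (D.block (x a))).getD (D.blockAnswer x A a) 0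
  | _ => D.markedServers.getD (D.lrAnswer x a) 0

/-- The state of DIVIDE before the request `a`. -/
def stateAt (a : ℕ) : DivideState where
  setup := D
  past := (List.range a).map x
  unmarked i := D.blockRequests x i a
  lr := markedLRState (D.markAt x) x (D.positions D.markedServers) a

variable {D x}

theorem mem_unmarkedRequests {i a b : ℕ} :
    b ∈ D.unmarkedRequests x i a ↔ b < a ∧ D.markAt x b = .unmarked ∧ D.block (x b) = i := by
  simp [unmarkedRequests]

theorem nodup_unmarkedRequests (i a : ℕ) : (D.unmarkedRequests x i a).Nodup :=
  List.nodup_range.filter _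

theorem unmarkedRequests_succ_of_mem {a : ℕ} (hm : D.markAt x a = .unmarked) :
    D.unmarkedRequests x (D.block (x a)) (a + 1) =
      D.unmarkedRequests x (D.block (x a)) a ++ [a] := by
  simp [unmarkedRequests, List.range_succ, List.filter_append, hm]

theorem unmarkedRequests_succ_of_notMem {i a : ℕ}
    (h : ¬ (D.markAt x a = .unmarked ∧ D.block (x a) = i)) :
    D.unmarkedRequests x i (a + 1) = D.unmarkedRequests x i a := by
  simp [unmarkedRequests, List.range_succ, List.filter_append, h]

theorem answer_of_marked (A : OnlineAlg) {a : ℕ} (hm : D.markAt x a ≠ .unmarked) :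
    D.answer x A a = D.markedServers.getD (D.lrAnswer x a) 0 := by
  grind [answer]

theorem answer_of_unmarked (A : OnlineAlg) {a : ℕ} (hm : D.markAt x a = .unmarked) :
    D.answer x A a = (D.unmarkedServers (D.block (x a))).getD (D.blockAnswer x A a) 0 := by
  simp only [answer, hm]

end DivideSetup

theorem divideStep_of_marked (A : OnlineAlg) {st : DivideState} {y : ℝ}
    (hm : st.setup.mark st.past y ≠ .unmarked) :
    divideStep A st y = divideMarkedStep st y (st.setup.mark st.past y).lrBit := by
  unfold divideStep
  cases h : st.setup.mark st.past y
  exacts [absurd h hm, rfl, rfl]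

theorem divideStep_of_unmarked (A : OnlineAlg) {st : DivideState} {y : ℝ}
    (hm : st.setup.mark st.past y = .unmarked) :
    divideStep A st y = divideUnmarkedStep A st y := by
  simp only [divideStep, hm]

namespace DivideSetup

theorem divideStep_stateAt (D : DivideSetup) (x : ℕ → ℝ) (A : OnlineAlg) (a : ℕ) :
    divideStep A (D.stateAt x a) (x a) = (D.answer x A a, D.stateAt x (a + 1)) := by
  have hpast : (List.range (a + 1)).map x = (List.range a).map x ++ [x a] := by
    rw [List.range_succ, List.map_append, List.map_singleton]
  by_cases hm : D.markAt x a = .unmarked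
  · have hunmarked : (fun i => D.blockRequests x i (a + 1)) =
        Function.update (fun i => D.blockRequests x i a) (D.block (x a))
          (D.blockRequests x (D.block (x a)) a ++ [x a]) := by
      ext1 i
      rcases eq_or_ne i (D.block (x a)) with rfl | hi
      · rw [Function.update_self, blockRequests, unmarkedRequests_succ_of_mem hm, List.map_append,
          List.map_singleton, blockRequests]
      · rw [Function.update_of_ne hi, blockRequests,
          unmarkedRequests_succ_of_notMem fun h => hi h.2.symm, blockRequests]
    rw [divideStep_of_unmarked (st := D.stateAt x a) A hm, answer_of_unmarked A hm, stateAt,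
      stateAt, hpast, hunmarked, markedLRState_succ_of_unmarked hm]
    rfl
  · have hunmarked (i : ℕ) : D.unmarkedRequests x i (a + 1) = D.unmarkedRequests x i a :=
      unmarkedRequests_succ_of_notMem fun h => hm h.1
    rw [divideStep_of_marked (st := D.stateAt x a) A hm, answer_of_marked A hm, divideMarkedStep,
      lrStep_run]
    simp only [stateAt, blockRequests, hpast, hunmarked, markedLRState_succ_of_marked hm]
    rfl

theorem output_block (D : DivideSetup) (x : ℕ → ℝ) (A : OnlineAlg) (i : ℕ) :
    A.output (D.blockServers i) (D.blockRequests x i D.n) =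
      (D.unmarkedRequests x i D.n).map (D.blockAnswer x A) := by
  classical
  have hserve := serve_filter A (D.blockServers i) x
    (fun b => D.markAt x b = .unmarked ∧ D.block (x b) = i) 0 D.n
  rw [← List.range_eq_range'] at hserve
  refine hserve.trans (List.map_congr_left fun b hb => ?_)
  obtain ⟨-, -, rfl⟩ := mem_unmarkedRequests.1 hb
  rfl

variable {D : DivideSetup} {x : ℕ → ℝ}

theorem nodup_markedServers : D.markedServers.Nodup := List.nodup_range.filter _

theorem nodup_unmarkedServers (i : ℕ) : (D.unmarkedServers i).Nodup := List.nodup_range.filter _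

theorem length_positions (l : List ℕ) : (D.positions l).length = l.length := List.length_map _

theorem getD_positions {l : List ℕ} {q : ℕ} (hq : q < l.length) :
    (D.positions l).getD q 0 = D.serverPos (l.getD q 0) := by
  simp [positions, serverPos, hq]

theorem getD_positions_idxOf {l : List ℕ} {j : ℕ} (hj : j ∈ l) :
    (D.positions l).getD (l.idxOf j) 0 = D.serverPos j := by
  have hlt := List.idxOf_lt_length_of_mem hj
  rw [getD_positions hlt, List.getD_eq_getElem _ _ hlt, List.getElem_idxOf]

theorem lt_of_mem_markedServers {j : ℕ} (hj : j ∈ D.markedServers) : j < D.n :=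
  List.mem_range.1 (List.mem_of_mem_filter hj)

theorem lt_of_mem_unmarkedServers {i j : ℕ} (hj : j ∈ D.unmarkedServers i) : j < D.n :=
  List.mem_range.1 (List.mem_of_mem_filter hj)

theorem notMem_markedServers_of_mem_unmarkedServers {i j : ℕ} (hj : j ∈ D.unmarkedServers i) :
    j ∉ D.markedServers := by
  simp only [unmarkedServers, markedServers, List.mem_filter, decide_eq_true_eq] at hj ⊢
  tauto

theorem _root_.IsDivideInput.sorted_positions (h : IsDivideInput D x) {l : List ℕ}
    (hl : l.Sublist (List.range D.n)) : (D.positions l).Pairwise (· ≤ ·) :=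
  List.pairwise_map.2 <| (List.pairwise_lt_range.sublist hl).imp_of_mem fun _ hj hij =>
    h.serverPos_mono hij.le (List.mem_range.1 (hl.subset hj))

namespace IsAdvised

open BlockSystem

variable (h : IsAdvised D x)

include h

theorem exists_server_eq {j : ℕ} (hj : j < D.n) : ∃ a < D.n, h.blockSystem.server a = j :=
  BlockSystem.exists_server_eq (S := h.blockSystem) hj

theorem eq_of_server_eq {a b : ℕ} (ha : a < D.n) (hb : b < D.n)
    (hab : h.blockSystem.server a = h.blockSystem.server b) : a = b :=
  server_injOn (S := h.blockSystem) (Finset.mem_coe.2 (Finset.mem_range.2 ha))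
    (Finset.mem_coe.2 (Finset.mem_range.2 hb)) hab

theorem map_server_perm (i : ℕ) :
    ((D.unmarkedRequests x i D.n).map h.blockSystem.server).Perm (D.unmarkedServers i) := by
  refine (List.perm_ext_iff_of_nodup ?_ (nodup_unmarkedServers i)).2 fun j => ?_
  · exact (nodup_unmarkedRequests i D.n).map_on fun a ha b hb =>
      h.eq_of_server_eq (mem_unmarkedRequests.1 ha).1 (mem_unmarkedRequests.1 hb).1
  · rw [List.mem_map]
    constructor
    · rintro ⟨a, ha, rfl⟩
      rw [mem_unmarkedRequests] at ha
      exact (h.server_mem_unmarkedServers_iff ha.1).2 ha.2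
    · intro hj
      obtain ⟨a, ha, rfl⟩ := h.exists_server_eq (lt_of_mem_unmarkedServers hj)
      exact ⟨a, mem_unmarkedRequests.2 ⟨ha, (h.server_mem_unmarkedServers_iff ha).1 hj⟩, rfl⟩

theorem isInput_block (i : ℕ) : IsInput (D.blockServers i) (D.blockRequests x i D.n) where
  sorted := h.sorted_positions List.filter_sublist
  length_eq := by
    rw [blockRequests, blockServers, length_positions, List.length_map,
      ← (h.map_server_perm i).length_eq, List.length_map]

theorem length_blockServers_le (i : ℕ) : (D.blockServers i).length ≤ D.n ⌈/⌉ D.k := by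
  refine le_trans ?_ (blockEnd_sub_le (n := D.n) h.one_le_k i)
  rw [blockServers, length_positions, ← List.toFinset_card_of_nodup (nodup_unmarkedServers i),
    ← Nat.card_Ico]
  refine Finset.card_le_card fun j hj => ?_
  simp only [unmarkedServers, List.mem_toFinset, List.mem_filter, decide_eq_true_eq] at hj
  exact Finset.mem_Ico.2 ⟨hj.2.1, hj.2.2.1⟩

theorem optCost_block_le (i : ℕ) :
    optCost (D.blockServers i) (D.blockRequests x i D.n) ≤
      ((D.unmarkedRequests x i D.n).map
        fun b => |x b - D.serverPos (h.blockSystem.server b)|).sum := by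
  have hperm := h.map_server_perm i
  have hmatching : IsMatching (D.blockServers i) ((D.unmarkedRequests x i D.n).map
      fun b => (D.unmarkedServers i).idxOf (h.blockSystem.server b)) := by
    have hidx := hperm.map fun j => (D.unmarkedServers i).idxOf j
    rw [map_idxOf_self (nodup_unmarkedServers i), List.map_map] at hidx
    rwa [IsMatching, blockServers, length_positions]
  refine (optCost_le _ hmatching).trans_eq ?_
  rw [blockRequests, matchingCost_map]
  refine congrArg List.sum (List.map_congr_left fun b hb => ?_)
  rw [blockServers, getD_positions_idxOf (hperm.subset (List.mem_map_of_mem hb))]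

theorem isLRPlan : IsLRPlan (D.markAt x) x (D.positions D.markedServers) D.n
    (fun b => D.markedServers.idxOf (h.blockSystem.server b)) 0 := by
  have hlt {b : ℕ} (hb : b ∈ markedFrom (D.markAt x) D.n 0) : b < D.n := (mem_markedFrom.1 hb).1.2
  have hmem {b : ℕ} (hb : b ∈ markedFrom (D.markAt x) D.n 0) :
      h.blockSystem.server b ∈ D.markedServers :=
    (h.server_mem_markedServers_iff (hlt hb)).2 (mem_markedFrom.1 hb).2
  refine ⟨fun b hb => mem_lrInit.2 ⟨?_, rfl⟩, fun b hb c hc hbc => ?_, ?_, ?_, ?_⟩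
  · rw [length_positions]
    exact List.idxOf_lt_length_of_mem (hmem hb)
  · exact h.eq_of_server_eq (hlt hb) (hlt hc) ((List.idxOf_inj (hmem hb)).1 hbc)
  · intro b hb hr
    rw [getD_positions_idxOf (hmem hb)]
    exact h.le_serverPos_of_mark_eq_right (hlt hb) (h.markAt_eq (hlt hb) ▸ hr)
  · intro b hb hl
    rw [getD_positions_idxOf (hmem hb)]
    exact h.serverPos_lt_of_mark_eq_left (hlt hb) (h.markAt_eq (hlt hb) ▸ hl)
  · intro b hb c hc hr hl
    rw [getD_positions_idxOf (hmem hb), getD_positions_idxOf (hmem hc)]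
    rcases le_or_gt (h.blockSystem.server b) (h.blockSystem.server c) with hle | hcb
    · exact Or.inl (h.serverPos_mono hle (server_lt (hlt hc)))
    · refine Or.inr (not_lt.1 fun hbc => hbc.ne ?_)
      exact h.eq_of_pos_eq (hlt hb) (hlt hc)
        (le_antisymm (pos_mono hbc.le) (pos_le_of_server_lt (hlt hc) (hlt hb) hcb))
        (h.markAt_eq (hlt hb) ▸ hr) (h.markAt_eq (hlt hc) ▸ hl)

theorem lrAnswer_optimal :
    (∀ b ∈ markedFrom (D.markAt x) D.n 0, D.lrAnswer x b < D.markedServers.length) ∧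
    Set.InjOn (D.lrAnswer x) (markedFrom (D.markAt x) D.n 0) ∧
    ∑ b ∈ markedFrom (D.markAt x) D.n 0,
        |x b - D.serverPos (D.markedServers.getD (D.lrAnswer x b) 0)| ≤
      ∑ b ∈ markedFrom (D.markAt x) D.n 0, |x b - D.serverPos (h.blockSystem.server b)| := by
  obtain ⟨hmem, hinj, hcost⟩ := h.isLRPlan.markedLRAnswer_optimal
    (h.sorted_positions List.filter_sublist) (Nat.zero_le _) fun b c hbc hc hl hr hx =>
      pos_ne_of_left_of_right (S := h.blockSystem) hbc hc (h.markAt_eq (hbc.trans hc) ▸ hl)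
        (h.markAt_eq hc ▸ hr) (congrArg D.pos hx)
  have hlt : ∀ b ∈ markedFrom (D.markAt x) D.n 0, D.lrAnswer x b < D.markedServers.length :=
    fun b hb => length_positions D.markedServers ▸ (mem_lrInit.1 (hmem b hb)).1
  refine ⟨hlt, hinj, le_of_eq_of_le ?_ (hcost.trans_eq ?_)⟩
  · exact Finset.sum_congr rfl fun b hb => by rw [← getD_positions (hlt b hb), lrAnswer]
  · refine Finset.sum_congr rfl fun b hb => ?_
    rw [mem_markedFrom] at hb
    rw [getD_positions_idxOf ((h.server_mem_markedServers_iff hb.1.2).2 hb.2)]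

end IsAdvised

end DivideSetup

namespace DivideSetup

variable {D : DivideSetup} {x : ℕ → ℝ} {A : OnlineAlg}

/-- In every block, `A` produces a perfect matching of the unmarked requests to the unmarked
servers. -/
def ServesBlocks (D : DivideSetup) (x : ℕ → ℝ) (A : OnlineAlg) : Prop :=
  ∀ i, IsMatching (D.blockServers i) (A.output (D.blockServers i) (D.blockRequests x i D.n))

/-- The cost of `A` on the unmarked requests and servers of block `i`. -/
def blockCost (D : DivideSetup) (x : ℕ → ℝ) (A : OnlineAlg) (i : ℕ) : ℝ :=
  matchingCost (D.blockServers i) (D.blockRequests x i D.n)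
    (A.output (D.blockServers i) (D.blockRequests x i D.n))

theorem ServesBlocks.map_blockAnswer_perm (hA : D.ServesBlocks x A) (i : ℕ) :
    ((D.unmarkedRequests x i D.n).map (D.blockAnswer x A)).Perm
      (List.range (D.unmarkedServers i).length) := by
  have hi := hA i
  rwa [IsMatching, output_block, blockServers, length_positions] at hi

theorem ServesBlocks.blockAnswer_lt (hA : D.ServesBlocks x A) {a : ℕ} (ha : a < D.n)
    (hm : D.markAt x a = .unmarked) :
    D.blockAnswer x A a < (D.unmarkedServers (D.block (x a))).length :=
  List.mem_range.1 <| (hA.map_blockAnswer_perm _).subset <|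
    List.mem_map_of_mem (mem_unmarkedRequests.2 ⟨ha, hm, rfl⟩)

theorem ServesBlocks.answer_mem_unmarkedServers (hA : D.ServesBlocks x A) {a : ℕ} (ha : a < D.n)
    (hm : D.markAt x a = .unmarked) : D.answer x A a ∈ D.unmarkedServers (D.block (x a)) := by
  rw [answer_of_unmarked A hm, List.getD_eq_getElem _ _ (hA.blockAnswer_lt ha hm)]
  exact List.getElem_mem _

namespace IsAdvised

variable (h : IsAdvised D x)

include h

theorem lrAnswer_lt {a : ℕ} (ha : a < D.n) (hm : D.markAt x a ≠ .unmarked) :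
    D.lrAnswer x a < D.markedServers.length :=
  h.lrAnswer_optimal.1 a (mem_markedFrom.2 ⟨⟨Nat.zero_le _, ha⟩, hm⟩)

theorem answer_mem_markedServers (A : OnlineAlg) {a : ℕ} (ha : a < D.n)
    (hm : D.markAt x a ≠ .unmarked) : D.answer x A a ∈ D.markedServers := by
  rw [answer_of_marked A hm, List.getD_eq_getElem _ _ (h.lrAnswer_lt ha hm)]
  exact List.getElem_mem _

theorem block_eq_of_mem_unmarkedServers {i i' j : ℕ} (hi : j ∈ D.unmarkedServers i)
    (hi' : j ∈ D.unmarkedServers i') : i = i' := by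
  obtain ⟨a, ha, rfl⟩ := h.exists_server_eq (lt_of_mem_unmarkedServers hi)
  rw [h.server_mem_unmarkedServers_iff ha] at hi hi'
  exact hi.2.symm.trans hi'.2

theorem answer_inj_of_unmarked (hA : D.ServesBlocks x A) {a b : ℕ} (ha : a < D.n) (hb : b < D.n)
    (hma : D.markAt x a = .unmarked) (hmb : D.markAt x b = .unmarked)
    (hab : D.answer x A a = D.answer x A b) : a = b := by
  have hblock : D.block (x b) = D.block (x a) := h.block_eq_of_mem_unmarkedServers
    (hab ▸ hA.answer_mem_unmarkedServers hb hmb) (hA.answer_mem_unmarkedServers ha hma)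
  have hlt := hA.blockAnswer_lt hb hmb
  rw [answer_of_unmarked A hma, answer_of_unmarked A hmb, hblock] at hab
  rw [hblock] at hlt
  exact List.inj_on_of_nodup_map ((hA.map_blockAnswer_perm _).nodup_iff.2 List.nodup_range)
    (mem_unmarkedRequests.2 ⟨ha, hma, rfl⟩) (mem_unmarkedRequests.2 ⟨hb, hmb, hblock⟩)
    (getD_inj_of_nodup (nodup_unmarkedServers _) (hA.blockAnswer_lt ha hma) hlt hab)

theorem answer_inj (hA : D.ServesBlocks x A) {a b : ℕ} (ha : a < D.n) (hb : b < D.n)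
    (hab : D.answer x A a = D.answer x A b) : a = b := by
  by_cases hma : D.markAt x a = .unmarked <;> by_cases hmb : D.markAt x b = .unmarked
  · exact h.answer_inj_of_unmarked hA ha hb hma hmb hab
  · exact absurd (hab ▸ h.answer_mem_markedServers A hb hmb)
      (notMem_markedServers_of_mem_unmarkedServers (hA.answer_mem_unmarkedServers ha hma))
  · exact absurd (hab ▸ h.answer_mem_markedServers A ha hma)
      (notMem_markedServers_of_mem_unmarkedServers (hA.answer_mem_unmarkedServers hb hmb))
  · rw [answer_of_marked A hma, answer_of_marked A hmb] at hab
    exact h.lrAnswer_optimal.2.1 (mem_markedFrom.2 ⟨⟨Nat.zero_le _, ha⟩, hma⟩)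
      (mem_markedFrom.2 ⟨⟨Nat.zero_le _, hb⟩, hmb⟩)
      (getD_inj_of_nodup nodup_markedServers (h.lrAnswer_lt ha hma) (h.lrAnswer_lt hb hmb) hab)

theorem answer_lt (hA : D.ServesBlocks x A) {a : ℕ} (ha : a < D.n) : D.answer x A a < D.n := by
  by_cases hm : D.markAt x a = .unmarked
  · exact lt_of_mem_unmarkedServers (hA.answer_mem_unmarkedServers ha hm)
  · exact lt_of_mem_markedServers (h.answer_mem_markedServers A ha hm)

theorem map_answer_perm (hA : D.ServesBlocks x A) :
    ((List.range D.n).map (D.answer x A)).Perm (List.range D.n) := by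
  have hnodup : ((List.range D.n).map (D.answer x A)).Nodup :=
    List.nodup_range.map_on fun a ha b hb hab =>
      h.answer_inj hA (List.mem_range.1 ha) (List.mem_range.1 hb) hab
  refine (hnodup.subperm fun j hj => ?_).perm_of_length_le (by simp)
  obtain ⟨a, ha, rfl⟩ := List.mem_map.1 hj
  exact List.mem_range.2 (h.answer_lt hA (List.mem_range.1 ha))

theorem sum_eq_marked_add_blocks (g : ℕ → ℝ) :
    ∑ a ∈ Finset.range D.n, g a = ∑ a ∈ markedFrom (D.markAt x) D.n 0, g a +
      ∑ i ∈ Finset.Icc 1 D.k, ((D.unmarkedRequests x i D.n).map g).sum := by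
  classical
  rw [← Finset.sum_filter_add_sum_filter_not (Finset.range D.n) fun a => D.markAt x a ≠ .unmarked]
  congr 1
  · exact Finset.sum_congr (by ext a; simp [mem_markedFrom]) fun _ _ => rfl
  · rw [← Finset.sum_fiberwise_of_maps_to (t := Finset.Icc 1 D.k) (g := fun a => D.block (x a))
      fun a _ => Finset.mem_Icc.2 ⟨one_le_block (x a), h.block_le (x a)⟩]
    refine Finset.sum_congr rfl fun i _ => ?_
    rw [unmarkedRequests, sum_map_filter_range, Finset.filter_filter]
    simp only [not_not]

theorem sum_answer_le (hA : D.ServesBlocks x A) :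
    ∑ a ∈ Finset.range D.n, |x a - D.serverPos (D.answer x A a)| ≤
      ∑ a ∈ markedFrom (D.markAt x) D.n 0, |x a - D.serverPos (h.blockSystem.server a)| +
      ∑ i ∈ Finset.Icc 1 D.k, D.blockCost x A i := by
  rw [h.sum_eq_marked_add_blocks]
  refine add_le_add (le_of_eq_of_le ?_ h.lrAnswer_optimal.2.2) (Finset.sum_congr rfl ?_).le
  · exact Finset.sum_congr rfl fun a ha => by rw [answer_of_marked A (mem_markedFrom.1 ha).2]
  · intro i _
    rw [blockCost, output_block, blockRequests, matchingCost_map]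
    refine congrArg List.sum (List.map_congr_left fun b hb => ?_)
    obtain ⟨hlt, hm, rfl⟩ := mem_unmarkedRequests.1 hb
    rw [answer_of_unmarked A hm, blockServers, getD_positions (hA.blockAnswer_lt hlt hm)]

end IsAdvised

end DivideSetup

/-! ### The competitive ratio -/

theorem DivideSetup.matchingCost_eq_sum (D : DivideSetup) (x : ℕ → ℝ) (f : ℕ → ℕ) :
    matchingCost D.servers ((List.range D.n).map x) ((List.range D.n).map f) =
      ∑ a ∈ Finset.range D.n, |x a - D.serverPos (f a)| := by
  rw [matchingCost_map, sum_map_range]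
  rfl

theorem IsDivideInput.sum_server_le_optCost {D : DivideSetup} {x : ℕ → ℝ}
    (h : IsDivideInput D x) :
    ∑ a ∈ Finset.range D.n, |x a - D.serverPos (h.blockSystem.server a)| ≤
      optCost D.servers ((List.range D.n).map x) := by
  refine le_optCost fun m hm => ?_
  have hlen : m.length = D.n := hm.length_eq.trans List.length_range
  have hlt (a : ℕ) (ha : a < D.n) : m.getD a 0 < D.n := by
    rw [List.getD_eq_getElem _ _ (hlen.symm ▸ ha)]
    exact List.mem_range.1 (hm.subset (List.getElem_mem _))
  rw [← map_getD_range m 0, hlen, D.matchingCost_eq_sum]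
  refine h.sum_server_le hlt fun a ha b hb hab => ?_
  rw [Finset.coe_range, Set.mem_Iio, ← hlen] at ha hb
  exact getD_inj_of_nodup (hm.nodup_iff.2 List.nodup_range) ha hb hab

section Random

variable {Ω : Type*} [MeasurableSpace Ω] {A : Ω → OnlineAlg} {c : ℕ → ℝ}

theorem IsRandomMatching.measurable_comp {s : List ℝ} {f : Ω → List ℕ} (hf : IsRandomMatching s f)
    {β : Type*} [MeasurableSpace β] (g : List ℕ → β) : Measurable fun ω => g (f ω) := by
  let _ : MeasurableSpace (List ℕ) := ⊤
  exact (measurable_from_top (f := g)).comp (measurable_to_countable' fun m => hf.measurable m)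

theorem finite_isMatching (s : List ℝ) : {m | IsMatching s m}.Finite :=
  (List.finite_toSet (List.range s.length).permutations).subset fun _ => List.mem_permutations.2

theorem IsRandomMatching.integrable {s : List ℝ} {f : Ω → List ℕ} (hf : IsRandomMatching s f)
    (μ : Measure Ω) [IsFiniteMeasure μ] (g : List ℕ → ℝ) : Integrable (fun ω => g (f ω)) μ := by
  obtain ⟨C, hC⟩ := ((finite_isMatching s).image fun m => ‖g m‖).bddAbove
  exact Integrable.of_bound (hf.measurable_comp g).aestronglyMeasurable C
    (.of_forall fun ω => hC ⟨f ω, hf.isMatching ω, rfl⟩)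

theorem measurableSet_map_eq {α : Type*} (g : α → Ω → ℕ) (l : List α)
    (hg : ∀ a ∈ l, Measurable (g a)) (m : List ℕ) :
    MeasurableSet {ω | (l.map fun a => g a ω) = m} := by
  induction l generalizing m with
  | nil => simp
  | cons a l ih =>
    cases m with
    | nil => simp
    | cons j m =>
      simp only [List.map_cons, List.cons.injEq]
      exact (hg a List.mem_cons_self (measurableSet_singleton j)).inter
        (ih (fun b hb => hg b (List.mem_cons_of_mem a hb)) m)

theorem matchingCost_replicate_zero (k : ℕ) (r : List ℝ) {m : List ℕ} (hm : m.length = r.length) :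
    matchingCost (List.replicate k 0) r m = (r.map (|·|)).sum := by
  have hzero (j : ℕ) : (List.replicate k (0 : ℝ)).getD j 0 = 0 := by
    by_cases hj : j < k <;> simp [hj]
  simp only [matchingCost, hzero, sub_zero]
  rw [← List.map_uncurry_zip_eq_zipWith, ← List.map_fst_zip hm.ge, List.map_map]
  simp [Function.comp_def, Function.uncurry_def, List.map_fst_zip hm.ge]

/-- All servers at `0` and all requests at `t`: every algorithm pays `n * t = OPT`. -/
theorem IsCompetitive.mul_le {μ : Measure Ω} [IsProbabilityMeasure μ] (hA : IsCompetitive μ A c)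
    (n : ℕ) : ∃ a, ∀ t : ℝ, 0 ≤ t → n * t ≤ c n * (n * t) + a := by
  obtain ⟨a, ha⟩ := hA
  refine ⟨a, fun t ht => ?_⟩
  set s := List.replicate n (0 : ℝ) with hs
  set r := List.replicate n t
  obtain ⟨hrandom, hle⟩ := ha s r ⟨by simp [s, List.pairwise_replicate], by simp [s, r]⟩
  have hcost {m : List ℕ} (hm : IsMatching s m) : matchingCost s r m = n * t := by
    rw [hs, matchingCost_replicate_zero n r (by simpa [s, r] using hm.length_eq)]
    simp [r, abs_of_nonneg ht]
  have hopt : optCost s r ≤ n * t :=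
    (optCost_le r (List.Perm.refl _)).trans_eq (hcost (List.Perm.refl _))
  have hopt' : n * t ≤ optCost s r := le_optCost fun m hm => (hcost hm).ge
  simp only [hcost (hrandom.isMatching _), integral_const, probReal_univ, smul_eq_mul, one_mul,
    le_antisymm hopt hopt'] at hle
  rwa [hs, List.length_replicate] at hle

theorem IsCompetitive.one_le {μ : Measure Ω} [IsProbabilityMeasure μ] (hA : IsCompetitive μ A c)
    {n : ℕ} (hn : 1 ≤ n) : 1 ≤ c n := by
  obtain ⟨a, ha⟩ := hA.mul_le n
  by_contra! hc
  have hbound (t : ℝ) (ht : 0 ≤ t) : (1 - c n) * n * t ≤ a := by linarith [ha t ht]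
  have hpos : 0 < (1 - c n) * n := mul_pos (sub_pos.2 hc) (by exact_mod_cast hn)
  have ha0 : 0 ≤ a := by simpa using hbound 0 le_rfl
  have := hbound ((a + 1) / ((1 - c n) * n)) (by positivity)
  rw [mul_div_cancel₀ _ hpos.ne'] at this
  linarith

namespace DivideSetup.IsAdvised

variable {D : DivideSetup} {x : ℕ → ℝ} (h : IsAdvised D x)

include h

theorem measurable_answer
    (hA : ∀ s r, IsInput s r → IsRandomMatching s fun ω => (A ω).output s r) {a : ℕ}
    (ha : a < D.n) : Measurable fun ω => D.answer x (A ω) a := by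
  by_cases hm : D.markAt x a = .unmarked
  · have hmem : a ∈ D.unmarkedRequests x (D.block (x a)) D.n :=
      mem_unmarkedRequests.2 ⟨ha, hm, rfl⟩
    have hlt := List.idxOf_lt_length_of_mem hmem
    convert (hA _ _ (h.isInput_block (D.block (x a)))).measurable_comp fun l =>
      (D.unmarkedServers (D.block (x a))).getD
        (l.getD ((D.unmarkedRequests x (D.block (x a)) D.n).idxOf a) 0) 0 using 2 with ω
    rw [answer_of_unmarked _ hm, output_block, List.getD_eq_getElem (List.map _ _) _
      (by rwa [List.length_map]), List.getElem_map, List.getElem_idxOf]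
  · simp only [answer_of_marked _ hm]
    exact measurable_const

theorem isRandomMatching_answer
    (hA : ∀ s r, IsInput s r → IsRandomMatching s fun ω => (A ω).output s r)
    {s : List ℝ} (hs : s.length = D.n) :
    IsRandomMatching s fun ω => (List.range D.n).map (D.answer x (A ω)) where
  isMatching ω := by
    rw [IsMatching, hs]
    exact h.map_answer_perm fun i => (hA _ _ (h.isInput_block i)).isMatching ω
  measurable := measurableSet_map_eq (fun a ω => D.answer x (A ω) a) _
    fun _ ha => h.measurable_answer hA (List.mem_range.1 ha)

theorem integrable_sum_answer {μ : Measure Ω} [IsFiniteMeasure μ]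
    (hA : ∀ s r, IsInput s r → IsRandomMatching s fun ω => (A ω).output s r) :
    Integrable (fun ω => ∑ a ∈ Finset.range D.n, |x a - D.serverPos (D.answer x (A ω) a)|) μ := by
  have hanswer := (h.isRandomMatching_answer hA (s := D.servers) rfl).integrable μ
    (matchingCost D.servers ((List.range D.n).map x))
  simp only [matchingCost_map, sum_map_range] at hanswer
  exact hanswer

theorem integral_blockCost_le {μ : Measure Ω} (hc : Monotone c) {d : ℝ}
    (hA : ∀ s r, IsInput s r →
      ∫ ω, matchingCost s r ((A ω).output s r) ∂μ ≤ c s.length * optCost s r + d)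
    (hc0 : 0 ≤ c (D.n ⌈/⌉ D.k)) (i : ℕ) :
    ∫ ω, D.blockCost x (A ω) i ∂μ ≤ c (D.n ⌈/⌉ D.k) * ((D.unmarkedRequests x i D.n).map
      fun b => |x b - D.serverPos (h.blockSystem.server b)|).sum + d := by
  refine (hA _ _ (h.isInput_block i)).trans (add_le_add_left ?_ d)
  exact mul_le_mul (hc (h.length_blockServers_le i)) (h.optCost_block_le i)
    (optCost_nonneg _ _) hc0

theorem integral_sum_answer_le {μ : Measure Ω} [IsProbabilityMeasure μ] (hc : Monotone c)
    {d : ℝ}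
    (hA : ∀ s r, IsInput s r → IsRandomMatching s (fun ω => (A ω).output s r) ∧
      ∫ ω, matchingCost s r ((A ω).output s r) ∂μ ≤ c s.length * optCost s r + d)
    (hc1 : 1 ≤ c (D.n ⌈/⌉ D.k)) :
    ∫ ω, ∑ a ∈ Finset.range D.n, |x a - D.serverPos (D.answer x (A ω) a)| ∂μ ≤
      c (D.n ⌈/⌉ D.k) *
        ∑ a ∈ Finset.range D.n, |x a - D.serverPos (h.blockSystem.server a)| + D.k * d := by
  have hA' (s r) (hsr : IsInput s r) := (hA s r hsr).1
  have hblock (i : ℕ) (_ : i ∈ Finset.Icc 1 D.k) :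
      Integrable (fun ω => D.blockCost x (A ω) i) μ :=
    (hA' _ _ (h.isInput_block i)).integrable μ _
  set marked := ∑ a ∈ markedFrom (D.markAt x) D.n 0, |x a - D.serverPos (h.blockSystem.server a)|
  calc ∫ ω, ∑ a ∈ Finset.range D.n, |x a - D.serverPos (D.answer x (A ω) a)| ∂μ
      ≤ ∫ ω, (marked + ∑ i ∈ Finset.Icc 1 D.k, D.blockCost x (A ω) i) ∂μ :=
        integral_mono (h.integrable_sum_answer hA')
          ((integrable_const _).add (integrable_finsetSum _ hblock)) fun ω =>
            h.sum_answer_le fun i => (hA' _ _ (h.isInput_block i)).isMatching ω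
    _ = marked + ∑ i ∈ Finset.Icc 1 D.k, ∫ ω, D.blockCost x (A ω) i ∂μ := by
        rw [integral_add (integrable_const _) (integrable_finsetSum _ hblock),
          integral_finsetSum _ hblock, integral_const, probReal_univ, one_smul]
    _ ≤ c (D.n ⌈/⌉ D.k) * marked + ∑ i ∈ Finset.Icc 1 D.k, (c (D.n ⌈/⌉ D.k) *
          ((D.unmarkedRequests x i D.n).map
            fun b => |x b - D.serverPos (h.blockSystem.server b)|).sum + d) :=
        add_le_add (le_mul_of_one_le_left (Finset.sum_nonneg fun _ _ => abs_nonneg _) hc1)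
          (Finset.sum_le_sum fun i _ => h.integral_blockCost_le hc (fun s r hsr => (hA s r hsr).2)
            (zero_le_one.trans hc1) i)
    _ = c (D.n ⌈/⌉ D.k) * ∑ a ∈ Finset.range D.n, |x a - D.serverPos (h.blockSystem.server a)| +
          D.k * d := by
        rw [h.sum_eq_marked_add_blocks, Finset.sum_add_distrib, mul_add, ← Finset.mul_sum,
          add_assoc, Finset.sum_const, Nat.card_Icc, Nat.add_sub_cancel, nsmul_eq_mul]

theorem integral_matchingCost_le {μ : Measure Ω}
    [IsProbabilityMeasure μ] (hc : Monotone c) {d : ℝ}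
    (hA : ∀ s r, IsInput s r → IsRandomMatching s (fun ω => (A ω).output s r) ∧
      ∫ ω, matchingCost s r ((A ω).output s r) ∂μ ≤ c s.length * optCost s r + d)
    (hc1 : 1 ≤ c (D.n ⌈/⌉ D.k)) :
    ∫ ω, matchingCost D.servers ((List.range D.n).map x)
        ((List.range D.n).map (D.answer x (A ω))) ∂μ ≤
      c (D.n ⌈/⌉ D.k) * optCost D.servers ((List.range D.n).map x) + D.k * d := by
  simp only [D.matchingCost_eq_sum]
  refine (h.integral_sum_answer_le hc hA hc1).trans ?_
  gcongr
  exact h.sum_server_le_optCost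

end DivideSetup.IsAdvised

end Random

/-! ### RESCALE -/

theorem abs_rescale_sub_le (s : List ℝ) (u v : ℝ) :
    |(|rescaleRequest s u - rescaleServer s v|) - (s.length : ℝ) ^ 3 * (|u - v|)| ≤ 1 := by
  have hscale : (s.length : ℝ) ^ 3 * |u - v| = |(s.length : ℝ) ^ 3 * (u - v)| := by
    rw [abs_mul, abs_of_nonneg (a := (s.length : ℝ) ^ 3) (by positivity)]
  set y := (s.length : ℝ) ^ 3 * (u - s.headD 0) with hy
  have hround : rescaleRequest s u - rescaleServer s v - (s.length : ℝ) ^ 3 * (u - v) =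
      -Int.fract y := by
    rw [rescaleRequest, rescaleServer, ← hy, ← Int.self_sub_floor]
    linarith
  rw [hscale]
  refine (abs_abs_sub_abs_le _ _).trans ?_
  rw [hround, abs_neg, Int.abs_fract]
  exact (Int.fract_lt_one y).le

theorem headD_le {s : List ℝ} (hs : s.Pairwise (· ≤ ·)) {v : ℝ} (hv : v ∈ s) :
    s.headD 0 ≤ v := by
  cases s with
  | nil => exact absurd hv List.not_mem_nil
  | cons u s =>
    rcases List.mem_cons.1 hv with rfl | hv
    exacts [le_rfl, (List.pairwise_cons.1 hs).1 v hv]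

theorem le_getLastD {s : List ℝ} (hs : s.Pairwise (· ≤ ·)) {v : ℝ} (hv : v ∈ s) :
    v ≤ s.getLastD 0 := by
  rcases List.eq_nil_or_concat' s with rfl | ⟨l, u, rfl⟩
  · exact absurd hv List.not_mem_nil
  · rw [List.getLastD_concat]
    rcases List.mem_append.1 hv with hv | hv
    exacts [(List.pairwise_append.1 hs).2.2 v hv u List.mem_cons_self, (List.mem_singleton.1 hv).le]

theorem serverSpan_nonneg {s : List ℝ} (hs : s.Pairwise (· ≤ ·)) : 0 ≤ serverSpan s := by
  rcases List.eq_nil_or_concat' s with rfl | ⟨l, u, rfl⟩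
  · simp [serverSpan]
  · have hu : u ∈ l ++ [u] := List.mem_append_right _ List.mem_cons_self
    exact sub_nonneg.2 ((headD_le hs hu).trans (le_getLastD hs hu))

theorem rescaleServer_mono (s : List ℝ) : Monotone (rescaleServer s) := fun u v huv => by
  unfold rescaleServer
  gcongr

theorem serverSpan_map_rescaleServer (s : List ℝ) :
    serverSpan (s.map (rescaleServer s)) = (s.length : ℝ) ^ 3 * serverSpan s := by
  rcases eq_or_ne s [] with rfl | hs
  · simp [serverSpan]
  · obtain ⟨u, l, hul⟩ := List.exists_cons_of_ne_nil hs
    have hlast : (s.map (rescaleServer s)).getLastD 0 = rescaleServer s (s.getLastD 0) := by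
      simp [List.getLastD_eq_getLast?, List.getLast?_map, List.getLast?_eq_getLast_of_ne_nil hs]
    have hhead : (s.map (rescaleServer s)).headD 0 = rescaleServer s (s.headD 0) := by
      generalize rescaleServer s = f
      simp [hul]
    rw [serverSpan, serverSpan, hlast, hhead, rescaleServer, rescaleServer]
    ring

theorem one_le_rescaleServer {s : List ℝ} (hs : s.Pairwise (· ≤ ·)) {u : ℝ} (hu : u ∈ s) :
    1 ≤ rescaleServer s u :=
  le_add_of_nonneg_left (mul_nonneg (by positivity) (sub_nonneg.2 (headD_le hs hu)))

theorem rescaleServer_add_one_le {s : List ℝ} (hs : s.Pairwise (· ≤ ·)) {u : ℝ} (hu : u ∈ s) :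
    rescaleServer s u + 1 ≤ rescaleN s := by
  have hspan : (s.length : ℝ) ^ 3 * (u - s.headD 0) ≤ (s.length : ℝ) ^ 3 * serverSpan s := by
    unfold serverSpan
    gcongr
    exact le_getLastD hs hu
  have hceil := Nat.le_ceil ((s.length : ℝ) ^ 3 * serverSpan s)
  rw [rescaleN, serverSpan_map_rescaleServer, rescaleServer]
  push_cast
  linarith

/-- The state of RESCALE on the servers `s` in which DIVIDE is in the state `st`. -/
def rescaleState (A : OnlineAlg) (k : ℕ) (s : List ℝ) (st : DivideState) : (RESCALE A k).State :=
  ⟨s, st⟩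

theorem rescale_init (A : OnlineAlg) (k : ℕ) (s : List ℝ) :
    (RESCALE A k).init s =
      divideInit k (rescaleN s) (s.map (rescaleServer s)) >>= fun st =>
        pure (rescaleState A k s st) :=
  rfl

theorem rescale_step (A : OnlineAlg) (k : ℕ) (s : List ℝ) (st : DivideState) (y : ℝ) :
    (RESCALE A k).step (rescaleState A k s st) y =
      pure ((divideStep A st (rescaleRequest s y)).1,
        rescaleState A k s (divideStep A st (rescaleRequest s y)).2) :=
  rfl

theorem rescale_step_stateAt (A : OnlineAlg) (k : ℕ) (s : List ℝ) (r : ℕ → ℝ) (D : DivideSetup)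
    (a : ℕ) :
    (RESCALE A k).step (rescaleState A k s (D.stateAt (fun b => rescaleRequest s (r b)) a)) (r a) =
      pure (D.answer (fun b => rescaleRequest s (r b)) A a,
        rescaleState A k s (D.stateAt (fun b => rescaleRequest s (r b)) (a + 1))) := by
  rw [rescale_step, D.divideStep_stateAt (fun b => rescaleRequest s (r b))]

theorem rescale_serve (A : OnlineAlg) (k : ℕ) (s : List ℝ) (r : ℕ → ℝ) (D : DivideSetup)
    (a m : ℕ) :
    (RESCALE A k).serve (rescaleState A k s (D.stateAt (fun b => rescaleRequest s (r b)) a))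
        ((List.range' a m).map r) =
      pure ((List.range' a m).map (D.answer (fun b => rescaleRequest s (r b)) A)) := by
  induction m generalizing a with
  | zero => rfl
  | succ m ih =>
    rw [List.range'_succ, List.map_cons, List.map_cons, AdviceAlg.serve.eq_def]
    simp only [rescale_step_stateAt]
    change (RESCALE A k).serve _ ((List.range' (a + 1) m).map r) >>= _ = _
    rw [ih (a + 1)]
    rfl

theorem rescale_run (A : OnlineAlg) (k : ℕ) (s : List ℝ) (r : ℕ → ℝ) {D : DivideSetup}
    {φ : ℕ → Bool} (hφ : ((divideRead k (rescaleN s) (s.map (rescaleServer s))).run φ).1 = D)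
    (n : ℕ) :
    ((RESCALE A k).init s >>= fun st => (RESCALE A k).serve st ((List.range n).map r)).run φ =
      ((List.range n).map (D.answer (fun b => rescaleRequest s (r b)) A),
        ((divideRead k (rescaleN s) (s.map (rescaleServer s))).run φ).2) := by
  have hinit : ((RESCALE A k).init s).run φ =
      (rescaleState A k s (D.stateAt (fun b => rescaleRequest s (r b)) 0),
        ((divideRead k (rescaleN s) (s.map (rescaleServer s))).run φ).2) := by
    rw [rescale_init, run_bind_pure, divideInit, run_bind_pure, hφ]
    rfl
  have hserve := rescale_serve A k s r D 0 n
  rw [← List.range_eq_range'] at hserve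
  rw [run_bind_of_eq_pure (by rw [hinit]; exact hserve), hinit]

theorem abs_matchingCost_sub_le {s s' r : List ℝ} {g : ℝ → ℝ} {t : ℝ} {m : List ℕ}
    (hg : ∀ u ∈ r, ∀ j ∈ m, |(|g u - s'.getD j 0|) - t * (|u - s.getD j 0|)| ≤ 1) :
    |matchingCost s' (r.map g) m - t * matchingCost s r m| ≤ m.length := by
  induction r generalizing m with
  | nil => simp [matchingCost]
  | cons u r ih =>
    cases m with
    | nil => simp [matchingCost]
    | cons j m =>
      have htail := ih fun v hv i hi =>
        hg v (List.mem_cons_of_mem u hv) i (List.mem_cons_of_mem j hi)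
      have hhead := hg u List.mem_cons_self j List.mem_cons_self
      simp only [matchingCost, List.map_cons, List.zipWith_cons_cons, List.sum_cons,
        List.length_cons, Nat.cast_add, Nat.cast_one] at htail ⊢
      rw [abs_le] at htail hhead ⊢
      constructor <;> linarith

theorem IsMatching.abs_matchingCost_rescale_sub_le {s : List ℝ} {m : List ℕ} (hm : IsMatching s m)
    (r : List ℝ) :
    |matchingCost (s.map (rescaleServer s)) (r.map (rescaleRequest s)) m -
      (s.length : ℝ) ^ 3 * matchingCost s r m| ≤ s.length := by
  have hlen : m.length = s.length := hm.length_eq.trans List.length_range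
  refine (abs_matchingCost_sub_le fun u _ j hj => ?_).trans_eq (congrArg Nat.cast hlen)
  have hj' : j < s.length := List.mem_range.1 (hm.subset hj)
  rw [List.getD_eq_getElem _ _ (by rwa [List.length_map]), List.getElem_map,
    List.getD_eq_getElem _ _ hj']
  exact abs_rescale_sub_le s u _

theorem optCost_rescale_le (s r : List ℝ) :
    optCost (s.map (rescaleServer s)) (r.map (rescaleRequest s)) ≤
      (s.length : ℝ) ^ 3 * optCost s r + s.length := by
  rcases eq_or_ne s [] with rfl | hs
  · simpa [matchingCost] using optCost_le (s := []) (r.map (rescaleRequest [])) (.refl _)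
  have hpos : (0 : ℝ) < (s.length : ℝ) ^ 3 := by
    have := List.length_pos_iff.2 hs
    positivity
  rw [← sub_le_iff_le_add, ← div_le_iff₀' hpos]
  refine le_optCost fun m hm => ?_
  rw [div_le_iff₀' hpos, sub_le_iff_le_add]
  have hm' : IsMatching (s.map (rescaleServer s)) m := by rwa [IsMatching, List.length_map]
  linarith [optCost_le (r.map (rescaleRequest s)) hm',
    (abs_le.1 (hm.abs_matchingCost_rescale_sub_le r)).2]

theorem IsRandomMatching.integral_matchingCost_rescale_le {Ω : Type*} [MeasurableSpace Ω]
    {μ : Measure Ω} [IsProbabilityMeasure μ] {s : List ℝ} {f : Ω → List ℕ}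
    (hf : IsRandomMatching s f) (r : List ℝ) :
    (s.length : ℝ) ^ 3 * ∫ ω, matchingCost s r (f ω) ∂μ ≤
      ∫ ω, matchingCost (s.map (rescaleServer s)) (r.map (rescaleRequest s)) (f ω) ∂μ +
        s.length := by
  have hcost := hf.integrable μ
    (matchingCost (s.map (rescaleServer s)) (r.map (rescaleRequest s)))
  have hsum : ∫ ω, (matchingCost (s.map (rescaleServer s)) (r.map (rescaleRequest s)) (f ω) +
      s.length) ∂μ = ∫ ω, matchingCost (s.map (rescaleServer s)) (r.map (rescaleRequest s)) (f ω)
        ∂μ + s.length := by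
    rw [integral_add hcost (integrable_const _), integral_const, probReal_univ, one_smul]
  rw [← hsum, ← integral_const_mul]
  refine integral_mono ((hf.integrable μ (matchingCost s r)).const_mul _)
    (hcost.add (integrable_const _)) fun ω => ?_
  change _ ≤ matchingCost _ _ _ + _
  linarith [(abs_le.1 ((hf.isMatching ω).abs_matchingCost_rescale_sub_le r)).1]

theorem isDivideInput_rescale {s : List ℝ} (hs : s.Pairwise (· ≤ ·)) {k : ℕ} (hk : 1 ≤ k)
    (hkn : k ≤ s.length) (r : ℕ → ℝ) {D : DivideSetup}
    (hservers : D.servers = s.map (rescaleServer s)) (hDk : D.k = k) (hDN : D.N = rescaleN s) :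
    IsDivideInput D (fun a => rescaleRequest s (r a)) where
  sorted := by
    rw [hservers]
    exact hs.map _ fun _ _ huv => rescaleServer_mono s huv
  one_le := by
    rw [hservers]
    exact List.forall_mem_map.2 fun u hu => one_le_rescaleServer hs hu
  le_N := by
    rw [hservers, hDN]
    exact List.forall_mem_map.2 fun u hu => rescaleServer_add_one_le hs hu
  int a := ⟨⌊(s.length : ℝ) ^ 3 * (r a - s.headD 0)⌋ + 1, by simp [rescaleRequest]⟩
  one_le_k := hDk ▸ hk
  k_le := by rwa [hDk, DivideSetup.n, hservers, List.length_map]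

/-- With advice from the tape `φ`, RESCALE on the input `s`, `r` runs DIVIDE with the correct setup
`D`, whatever its subroutine. -/
structure IsRescaleRun (D : DivideSetup) (k : ℕ) (s r : List ℝ) (φ : ℕ → Bool) : Prop extends
    D.IsAdvised (fun a => rescaleRequest s (r.getD a 0)) where
  servers_eq : D.servers = s.map (rescaleServer s)
  k_eq : D.k = k
  output_eq : ∀ A : OnlineAlg, (RESCALE A k).output s r φ =
    (List.range D.n).map (D.answer (fun a => rescaleRequest s (r.getD a 0)) A)
  bitsRead_le : ∀ A : OnlineAlg, (RESCALE A k).bitsRead s r φ ≤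
    (k - 1) * (2 * Nat.size (rescaleN s) + 4 * Nat.size s.length)

theorem IsInput.exists_isRescaleRun {s r : List ℝ} (hsr : IsInput s r) {k : ℕ} (hk : 1 ≤ k)
    (hkn : k ≤ s.length) : ∃ D φ, IsRescaleRun D k s r φ := by
  obtain ⟨D, hservers, hDk, hDN, h⟩ := (isDivideInput_rescale hsr.sorted hk hkn
    (fun a => r.getD a 0) (D := ⟨s.map (rescaleServer s), k, rescaleN s, fun _ => none,
      fun _ => none, 0, 0, 0, 0⟩) rfl rfl rfl).exists_isAdvised
  have hread := h.isReadable.yields_divideRead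
  have hn : D.n = r.length := by rw [DivideSetup.n, hservers, List.length_map, hsr.length_eq]
  rw [hn, hservers, hDk, hDN, hsr.length_eq] at hread
  obtain ⟨φ, hφ, hbits⟩ := hread.exists_run
  have hrun (A : OnlineAlg) := rescale_run A k s (fun a => r.getD a 0) hφ r.length
  simp only [map_getD_range] at hrun
  exact ⟨D, φ, h, hservers, hDk, fun A => hn ▸ congrArg Prod.fst (hrun A),
    fun A => (congrArg Prod.snd (hrun A)).trans_le hbits⟩

namespace IsRescaleRun

variable {Ω : Type*} [MeasurableSpace Ω] {A : Ω → OnlineAlg} {D : DivideSetup} {k : ℕ}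
  {s r : List ℝ} {φ : ℕ → Bool} (h : IsRescaleRun D k s r φ)

include h

theorem n_eq : D.n = s.length := by rw [DivideSetup.n, h.servers_eq, List.length_map]

theorem isRandomMatching_output
    (hA : ∀ s r, IsInput s r → IsRandomMatching s fun ω => (A ω).output s r) :
    IsRandomMatching s fun ω => (RESCALE (A ω) k).output s r φ := by
  simp only [h.output_eq]
  exact h.isRandomMatching_answer hA h.n_eq.symm

theorem integral_matchingCost_output_le {μ : Measure Ω} [IsProbabilityMeasure μ] {c : ℕ → ℝ}
    (hc : Monotone c) {d : ℝ} (hr : r.length = s.length)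
    (hA : ∀ s r, IsInput s r → IsRandomMatching s (fun ω => (A ω).output s r) ∧
      ∫ ω, matchingCost s r ((A ω).output s r) ∂μ ≤ c s.length * optCost s r + d)
    (hc1 : 1 ≤ c (s.length ⌈/⌉ k)) :
    (s.length : ℝ) ^ 3 * ∫ ω, matchingCost s r ((RESCALE (A ω) k).output s r φ) ∂μ ≤
      c (s.length ⌈/⌉ k) * ((s.length : ℝ) ^ 3 * optCost s r + s.length) + k * d + s.length := by
  have hrequests : (List.range D.n).map (fun a => rescaleRequest s (r.getD a 0)) =
      r.map (rescaleRequest s) := by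
    rw [h.n_eq, ← hr]
    conv_rhs => rw [← map_getD_range r 0, List.map_map]
    rfl
  have hdivide := h.toIsAdvised.integral_matchingCost_le hc hA (by rwa [h.n_eq, h.k_eq])
  simp only [← h.output_eq] at hdivide
  rw [hrequests, h.servers_eq, h.n_eq, h.k_eq] at hdivide
  refine ((h.isRandomMatching_output fun s r hsr =>
    (hA s r hsr).1).integral_matchingCost_rescale_le r).trans ?_
  gcongr
  refine hdivide.trans ?_
  gcongr
  exact optCost_rescale_le s r

end IsRescaleRun

/-! ### The number of advice bits -/

theorem size_le_logb {N : ℕ} (hN : N ≠ 0) : (Nat.size N : ℝ) ≤ Real.logb 2 N + 1 := by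
  have hsize : N.size = N.size - 1 + 1 := by
    have := Nat.size_pos.2 (Nat.pos_of_ne_zero hN)
    lia
  have hpow : (2 : ℝ) ^ (N.size - 1) ≤ N := by exact_mod_cast Nat.lt_size.1 (by lia)
  rw [hsize, Nat.cast_add_one, add_le_add_iff_right, ← Real.rpow_natCast] at *
  rwa [Real.le_logb_iff_rpow_le one_lt_two (by positivity)]

theorem rescaleN_le {s : List ℝ} (hs : 2 ≤ s.length) :
    (rescaleN s : ℝ) ≤ (s.length : ℝ) ^ 4 * max 1 (serverSpan s) := by
  have hn : (2 : ℝ) ≤ s.length := by exact_mod_cast hs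
  set n : ℝ := (s.length : ℝ)
  set M := max 1 (serverSpan s)
  have hM : 1 ≤ M := le_max_left _ _
  have hn3 : 2 ^ 3 ≤ n ^ 3 := by gcongr
  have hprod : 8 * 1 ≤ n ^ 3 * M := by gcongr; linarith
  have hceil : (⌈n ^ 3 * serverSpan s⌉₊ : ℝ) ≤ n ^ 3 * M + 1 := by
    refine (Nat.cast_le.2 (Nat.ceil_le_ceil ?_)).trans
      (Nat.ceil_lt_add_one (a := n ^ 3 * M) (by positivity)).le
    gcongr
    exact le_max_right _ _
  calc (rescaleN s : ℝ) = ⌈n ^ 3 * serverSpan s⌉₊ + 2 := by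
        rw [rescaleN, serverSpan_map_rescaleServer]
        push_cast
        rfl
    _ ≤ 2 * (n ^ 3 * M) := by linarith
    _ ≤ n * (n ^ 3 * M) := by gcongr
    _ = n ^ 4 * M := by ring

theorem log_rescaleN_le {s : List ℝ} (hs : s.Pairwise (· ≤ ·)) (hn : 2 ≤ s.length) :
    Real.log (rescaleN s) ≤ 4 * Real.log s.length + Real.posLog (serverSpan s) := by
  have hN : (0 : ℝ) < rescaleN s := by exact_mod_cast Nat.succ_pos _
  have hlen : (s.length : ℝ) ≠ 0 := by positivity
  have hM : max 1 (serverSpan s) ≠ 0 := (zero_lt_one.trans_le (le_max_left _ _)).ne'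
  calc Real.log (rescaleN s) ≤ Real.log ((s.length : ℝ) ^ 4 * max 1 (serverSpan s)) :=
        Real.log_le_log hN (rescaleN_le hn)
    _ = 4 * Real.log s.length + Real.posLog (serverSpan s) := by
        rw [Real.log_mul (pow_ne_zero 4 hlen) hM, Real.log_pow,
          Real.posLog_eq_log_max_one (serverSpan_nonneg hs), Nat.cast_ofNat]

theorem size_add_size_le {s : List ℝ} (hs : s.Pairwise (· ≤ ·)) (hn : 2 ≤ s.length) :
    (2 * Nat.size (rescaleN s) + 4 * Nat.size s.length : ℝ) ≤
      18 / Real.log 2 * (Real.posLog (serverSpan s) + Real.log s.length) := by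
  have hlog2 : Real.log 2 ≤ Real.log s.length := by gcongr; exact_mod_cast hn
  have hspan : 0 ≤ Real.posLog (serverSpan s) := Real.posLog_nonneg
  have hsizeN := size_le_logb (N := rescaleN s) (Nat.succ_ne_zero _)
  have hsizen := size_le_logb (show s.length ≠ 0 by lia)
  calc (2 * Nat.size (rescaleN s) + 4 * Nat.size s.length : ℝ)
      ≤ 2 * (Real.logb 2 (rescaleN s) + 1) + 4 * (Real.logb 2 s.length + 1) := by
        gcongr
    _ = (2 * Real.log (rescaleN s) + 4 * Real.log s.length + 6 * Real.log 2) / Real.log 2 := by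
        unfold Real.logb
        field_simp
        ring
    _ ≤ 18 * (Real.posLog (serverSpan s) + Real.log s.length) / Real.log 2 := by
        gcongr
        linarith [log_rescaleN_le hs hn]
    _ = 18 / Real.log 2 * (Real.posLog (serverSpan s) + Real.log s.length) := by ring

theorem IsRescaleRun.bitsRead_le_log {D : DivideSetup} {k : ℕ} {s r : List ℝ} {φ : ℕ → Bool}
    (h : IsRescaleRun D k s r φ) (hs : s.Pairwise (· ≤ ·)) (hk : k ≤ s.length) (A : OnlineAlg) :
    ((RESCALE A k).bitsRead s r φ : ℝ) ≤
      18 / Real.log 2 * (k * (Real.posLog (serverSpan s) + Real.log s.length)) := by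
  have hbits : ((RESCALE A k).bitsRead s r φ : ℝ) ≤
      ((k - 1 : ℕ) : ℝ) * (2 * Nat.size (rescaleN s) + 4 * Nat.size s.length) := by
    exact_mod_cast h.bitsRead_le A
  rcases Nat.lt_or_ge s.length 2 with hn | hn
  · have hk1 : k - 1 = 0 := by lia
    rw [hk1, Nat.cast_zero, zero_mul] at hbits
    have := Real.posLog_nonneg (x := serverSpan s)
    have := Real.log_natCast_nonneg s.length
    have := Real.log_pos one_lt_two
    exact hbits.trans (by positivity)
  · rw [mul_left_comm]
    refine hbits.trans (mul_le_mul ?_ (size_add_size_le hs hn) (by positivity) k.cast_nonneg)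
    exact_mod_cast k.sub_le 1

theorem le_of_cube_mul_le {n k cost opt c d K : ℝ} (hn : 1 ≤ n) (hk : 0 ≤ k) (hkn : k ≤ n)
    (hc : c ≤ K * n ^ 2) (h : n ^ 3 * cost ≤ c * (n ^ 3 * opt + n) + k * d + n) :
    cost ≤ c * opt + (K + |d| + 1) := by
  have hcn : c * n ≤ n ^ 3 * K := by
    calc c * n ≤ K * n ^ 2 * n := by gcongr
      _ = n ^ 3 * K := by ring
  have hn3 : n ≤ n ^ 3 := le_self_pow₀ hn three_ne_zero
  have hkd : k * d ≤ n ^ 3 * |d| :=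
    (mul_le_mul_of_nonneg_left (le_abs_self d) hk).trans
      (mul_le_mul_of_nonneg_right (hkn.trans hn3) (abs_nonneg d))
  refine le_of_mul_le_mul_left ?_ (show 0 < n ^ 3 by positivity)
  linarith

end

theorem mainTheorem4_general :
    ∃ C : ℝ, ∀ {Ω : Type*} [MeasurableSpace Ω] (μ : MeasureTheory.Measure Ω)
      [MeasureTheory.IsProbabilityMeasure μ] (A : Ω → OnlineAlg) (c : ℕ → ℝ),
      Monotone c →
      c =O[Filter.atTop] (fun m : ℕ => (m : ℝ) ^ 2) →
      IsCompetitive μ A c →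
      ∃ b : ℝ, ∀ (k : ℕ) (s r : List ℝ), IsInput s r → 1 ≤ k → k ≤ s.length →
        ∃ φ : ℕ → Bool,
          IsRandomMatching s (fun ω => (RESCALE (A ω) k).output s r φ) ∧
          ∫ ω, matchingCost s r ((RESCALE (A ω) k).output s r φ) ∂μ
            ≤ c (s.length ⌈/⌉ k) * optCost s r + b ∧
          ∀ ω, ((RESCALE (A ω) k).bitsRead s r φ : ℝ)
            ≤ C * (k * (Real.posLog (serverSpan s) + Real.log s.length)) := by
  refine ⟨18 / Real.log 2, fun μ _ A c hc hO hA => ?_⟩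
  obtain ⟨K, -, hK⟩ := Asymptotics.bound_of_isBigO_nat_atTop hO
  have hc1 {n : ℕ} (hn : 1 ≤ n) : 1 ≤ c n := hA.one_le hn
  obtain ⟨d, hd⟩ := hA
  refine ⟨K + |d| + 1, fun k s r hsr hk hkn => ?_⟩
  obtain ⟨D, φ, h⟩ := hsr.exists_isRescaleRun hk hkn
  have hn : (1 : ℝ) ≤ s.length := by exact_mod_cast hk.trans hkn
  have hceil_le : s.length ⌈/⌉ k ≤ s.length :=
    (ceilDiv_le_iff_le_mul hk).2 (Nat.le_mul_of_pos_left _ hk)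
  have hc_ceil : c (s.length ⌈/⌉ k) ≤ K * (s.length : ℝ) ^ 2 := by
    have hcn := hK (x := s.length) (by positivity)
    rw [Real.norm_eq_abs, norm_pow, Real.norm_natCast] at hcn
    exact (hc hceil_le).trans ((le_abs_self _).trans hcn)
  have hcost := h.integral_matchingCost_output_le hc hsr.length_eq hd
    (hc1 ((Nat.div_pos hkn hk).trans_le (floorDiv_le_ceilDiv (a := k) (b := s.length))))
  exact ⟨φ, h.isRandomMatching_output fun s r hsr => (hd s r hsr).1,
    le_of_cube_mul_le hn k.cast_nonneg (by exact_mod_cast hkn) hc_ceil hcost,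
    fun ω => h.bitsRead_le_log hsr.sorted hkn (A ω)⟩

theorem mainTheorem4 :
    ∃ C : ℝ, ∀ {Ω : Type*} [MeasurableSpace Ω] (μ : MeasureTheory.Measure Ω)
      [MeasureTheory.IsProbabilityMeasure μ] (A : Ω → OnlineAlg) (c : ℕ → ℝ),
      Monotone c →
      c =o[Filter.atTop] (fun m : ℕ => (m : ℝ) ^ 2) →
      IsCompetitive μ A c →
      ∃ b : ℝ, ∀ (k : ℕ) (s r : List ℝ), IsInput s r → 1 ≤ k → k ≤ s.length →
        ∃ φ : ℕ → Bool,
          IsRandomMatching s (fun ω => (RESCALE (A ω) k).output s r φ) ∧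
          ∫ ω, matchingCost s r ((RESCALE (A ω) k).output s r φ) ∂μ
            ≤ c (s.length ⌈/⌉ k) * optCost s r + b ∧
          ∀ ω, ((RESCALE (A ω) k).bitsRead s r φ : ℝ)
            ≤ C * (k * (Real.posLog (serverSpan s) + Real.log s.length)) := by
  obtain ⟨C, hC⟩ := mainTheorem4_general
  exact ⟨C, fun μ _ A c hc ho hA => hC μ A c hc ho.isBigO hA⟩
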